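/- Let $n\ge 1$. A simple polytope $P\subset\mathbb R^n$ is the convex hull of finitely many points, of dimension $n$, such that every vertex lies on exactly $n$ facets; $V(P)$ and $\mathcal F(P)$ denote its sets of vertices and facets. An $\mathcal R$-characteristic pair $(P,\lambda)$ consists of such a $P$ and a map $\lambda:\mathcal F(P)\to\mathbb Z^n$ with primitive values such that the vectors of any distinct facets with nonempty common intersection are linearly independent; it is a characteristic pair if moreover such vectors always span a direct summand of $\mathbb Z^n$. Let $T^n$ be the compact torus $(S^1)^n$. The toric orbifold of $(P,\lambda)$ is $M(P,\lambda)=(T^n\times P)/\!\sim$, where $(t,x)\sim(s,y)$ iff $x=y$ and $t^{-1}s$ lies in the subgroup generated by the circles $\exp(\mathbb R\lambda(F_i))$ over the facets $F_i\ni x$; $T^n$ acts on the first factor and $\pi:M(P,\lambda)\to P$ is the projection. $M(P,\lambda)$ is a toric manifold if $(P,\lambda)$ is a characteristic pair and $M(P,\lambda)$ is a closed smooth $2n$-manifold covered by $T^n$-invariant smooth charts to $\mathbb C^n$ in which the action is the standard one up to an automorphism of $T^n$, with $\pi$ as the quotient map by the $T^n$-action. For a face $F$ of $P$, with $F_{i_1},\dots,F_{i_k}$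 the facets containing $F$, put $$G_F(P,\lambda)=\frac{(\langle\lambda(F_{i_1}),\dots,\lambda(F_{i_k})\rangle\otimes\mathbb R)\cap\mathbb Z^n}{\langle\lambda(F_{i_1}),\dots,\lambda(F_{i_k})\rangle}.$$ If $H$ is a hyperplane with $V(F)\subset H_{>0}$ and $V(P)\setminus V(F)\subset H_{<0}$, then $\overline P=P\cap H_{\le 0}$ is a blowup of $P$ along $F$; if $(\overline P,\overline\lambda)$ is an $\mathcal R$-characteristic pair with $\overline\lambda(F_i\cap\overline P)=\lambda(F_i)$ whenever $F_i\in\mathcal F(P)$ and $F_i\cap\overline P$ is a facet of $\overline P$, then $M(\overline P,\overline\lambda)$ is called a blowup of $M(P,\lambda)$ along $\pi^{-1}(F)$. **Theorem.** For every $\mathcal R$-characteristic pair $(P,\lambda)$ there are $d\ge 0$ and a finite sequence of blowups $$M(P^{(d)},\lambda^{(d)})\to\dots\to M(P^{(1)},\lambda^{(1)})\to M(P^{(0)},\lambda^{(0)})=M(P,\lambda)$$ such that $M(P^{(d)},\lambda^{(d)})$ is a toric manifold and, for each $i=1,\dots,d$, $M(P^{(i)},\lambda^{(i)})$ is a blowup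 of $M(P^{(i-1)},\lambda^{(i-1)})$ along $\pi^{-1}(F)$ for a face $F$ of $P^{(i-1)}$ which is maximal among the faces with $|G_F(P^{(i-1)},\lambda^{(i-1)})|\ne1$, with the following properties. Let $H$ be the hyperplane used and $F_{i_1},\dots,F_{i_k}$ the facets of $P^{(i-1)}$ containing $F$. 1. $E=P^{(i-1)}\cap H$ is a facet of $P^{(i)}$, and $\lambda^{(i)}(E)$ is the primitive vector of a nonzero lattice point $\sum_{j=1}^k c_j\lambda^{(i-1)}(F_{i_j})\in\mathbb Z^n$ with $c_j\in\mathbb Q$ and $0<|c_j|<1$ for all $j$. 2. The vertices of $P^{(i)}$ not in $E$ are exactly the vertices of $P^{(i-1)}$ not in $F$, and the order of the group $G$ at these is the same for both pairs. 3. Every vertex $w$ of $P^{(i)}$ in $E$ lies over exactly one vertex $b$ of $F$, in the sense that every facet of $P^{(i-1)}$ through $w$ passes through $b$; over every vertex $b$ of $F$ lie exactly $k$ such vertices $w$; and $|G_w(P^{(i)},\lambda^{(i)})|<|G_b(P^{(i-1)},\lambda^{(i-1)})|$ for each of them. -/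

import Mathlib

noncomputable section

open scoped Manifold ContDiff

namespace ToricOrb

/-! ### Polytopes -/

/-- The nonempty faces of a convex polytope `P` (including `P` itself): the sets of maximizers on
`P` of linear functionals. -/
def IsFace {n : ℕ} (P F : Set (Fin n → ℝ)) : Prop :=
  IsExposed ℝ P F ∧ F.Nonempty

/-- Facets: faces of dimension `n - 1`. -/
def IsFacet {n : ℕ} (P F : Set (Fin n → ℝ)) : Prop :=
  IsFace P F ∧ Module.finrank ℝ (vectorSpan ℝ F) + 1 = n

/-- `V(P)`: the zero-dimensional faces. -/
def vertices {n : ℕ} (P : Set (Fin n → ℝ)) : Set (Fin n → ℝ) :=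
  {v | IsFace P {v}}

/-- `n`-dimensional simple polytopes in `ℝⁿ`: convex hulls of finitely many points, with nonempty
interior, such that every vertex lies on exactly `n` facets. -/
structure IsSimplePolytope {n : ℕ} (P : Set (Fin n → ℝ)) : Prop where
  exists_convexHull : ∃ s : Finset (Fin n → ℝ), P = convexHull ℝ (s : Set (Fin n → ℝ))
  interior_nonempty : (interior P).Nonempty
  ncard_facets : ∀ v ∈ vertices P, {F | IsFacet P F ∧ v ∈ F}.ncard = n

/-! ### Characteristic pairs -/

/-- Primitive vectors of `ℤⁿ`: the coordinates have no common divisor except `±1`. -/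
def IsPrimitiveVec {n : ℕ} (v : Fin n → ℤ) : Prop :=
  ∀ k : ℤ, (∀ i, k ∣ v i) → IsUnit k

/-- An `R`-characteristic pair `(P, lam)` in dimension `n`. -/
structure RCharPair (n : ℕ) where
  /-- the simple polytope `P` -/
  poly : Set (Fin n → ℝ)
  isSimple : IsSimplePolytope poly
  /-- the `R`-characteristic function on the set of facets of `P` -/
  lam : {F : Set (Fin n → ℝ) // IsFacet poly F} → (Fin n → ℤ)
  primitive : ∀ F, IsPrimitiveVec (lam F)
  indep : ∀ S : Set {F : Set (Fin n → ℝ) // IsFacet poly F},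
    (⋂ F ∈ S, F.1).Nonempty → LinearIndependent ℤ (fun F : S => lam F.1)

namespace RCharPair

variable {n : ℕ}

/-- The set of facets of the polytope. -/
abbrev Facet (A : RCharPair n) : Type := {F : Set (Fin n → ℝ) // IsFacet A.poly F}

/-- `(P, lam)` is a characteristic pair: facets with a common point have (linearly independent)
vectors which span a direct summand of `ℤⁿ`. -/
def IsCharacteristic (A : RCharPair n) : Prop :=
  ∀ S : Set A.Facet, (⋂ F ∈ S, F.1).Nonempty →
    ∃ N : Submodule ℤ (Fin n → ℤ), IsCompl (Submodule.span ℤ (A.lam '' S)) N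

/-- The characteristic vectors of the facets containing `F`. For a face `F` of codimension `k`
these are the vectors of the `k` facets whose intersection is `F`. -/
def vecs (A : RCharPair n) (F : Set (Fin n → ℝ)) : Set (Fin n → ℤ) :=
  A.lam '' {G | F ⊆ G.1}

end RCharPair

/-- The inclusion `ℤⁿ → ℝⁿ`. -/
def intCast (n : ℕ) : (Fin n → ℤ) →ₗ[ℤ] (Fin n → ℝ) :=
  (Int.castAddHom ℝ).toIntLinearMap.compLeft (Fin n)

/-- `(⟨S⟩ ⊗ ℝ) ∩ ℤⁿ`. -/
def saturation {n : ℕ} (S : Set (Fin n → ℤ)) : Submodule ℤ (Fin n → ℤ) :=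
  ((Submodule.span ℝ (intCast n '' S)).restrictScalars ℤ).comap (intCast n)

namespace RCharPair

variable {n : ℕ}

/-- The local group `G_F = ((⟨vecs F⟩ ⊗ ℝ) ∩ ℤⁿ) / ⟨vecs F⟩`. -/
abbrev localGroup (A : RCharPair n) (F : Set (Fin n → ℝ)) : Type :=
  saturation (A.vecs F) ⧸
    (Submodule.span ℤ (A.vecs F)).comap (saturation (A.vecs F)).subtype

/-- The order `|G_F|`. -/
def singOrder (A : RCharPair n) (F : Set (Fin n → ℝ)) : ℕ :=
  Nat.card (A.localGroup F)

/-! ### The space `M(P, lam)` -/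

/-- The circle subgroup of `Tⁿ` which is the image of the line `ℝ v` under the exponential map:
the elements `(z ^ v₁, …, z ^ vₙ)` with `z` in the unit circle. -/
def circleSubgroup (v : Fin n → ℤ) : Subgroup (Fin n → Circle) :=
  (MonoidHom.pi fun i => zpowGroupHom (α := Circle) (v i)).range

/-- `T_F`, the subgroup of `Tⁿ` generated by the circles of the facets containing `F`. -/
def faceTorus (A : RCharPair n) (F : Set (Fin n → ℝ)) : Subgroup (Fin n → Circle) :=
  ⨆ G : {G : A.Facet // F ⊆ G.1}, circleSubgroup (A.lam G.1)

/-- The relation `(t, x) ∼ (s, y)` iff `x = y` and `t⁻¹ s ∈ T_F`, where `F` is the face having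
`x` in its relative interior. A facet contains `F` iff it contains `x`, so `T_F = T_{x}`. -/
def toricSetoid (A : RCharPair n) : Setoid ((Fin n → Circle) × A.poly) where
  r p q := p.2 = q.2 ∧ p.1⁻¹ * q.1 ∈ A.faceTorus {p.2.1}
  iseqv :=
    { refl := fun p => ⟨rfl, by simp [one_mem]⟩
      symm := by
        rintro ⟨t, x⟩ ⟨s, y⟩ ⟨h, h'⟩
        dsimp only at h h'
        subst h
        refine ⟨rfl, ?_⟩
        simpa using inv_mem h'
      trans := by
        rintro ⟨t, x⟩ ⟨s, y⟩ ⟨u, z⟩ ⟨h, h'⟩ ⟨k, k'⟩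
        dsimp only at h h' k k'
        subst h
        subst k
        refine ⟨rfl, ?_⟩
        have := mul_mem h' k'
        simpa [mul_assoc] using this }

/-- The space `M(P, lam) = (Tⁿ × P) / ∼`. -/
def Space (A : RCharPair n) : Type := Quotient A.toricSetoid

/-- `M(P, lam)` carries the quotient topology. -/
instance (A : RCharPair n) : TopologicalSpace A.Space :=
  inferInstanceAs (TopologicalSpace (Quotient A.toricSetoid))

/-- The action of `Tⁿ` on `M(P, lam)` by multiplication on the first factor. -/
instance (A : RCharPair n) : MulAction (Fin n → Circle) A.Space where
  smul t := Quotient.map (sa := A.toricSetoid) (sb := A.toricSetoid)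
    (fun p => (t * p.1, p.2)) (by
      rintro p q ⟨h, h'⟩
      refine ⟨h, ?_⟩
      dsimp only
      rw [mul_inv_rev, mul_assoc, inv_mul_cancel_left]
      exact h')
  one_smul m := by
    induction m using Quotient.inductionOn with
    | h p => exact congrArg (Quotient.mk A.toricSetoid) (Prod.ext (one_mul _) rfl)
  mul_smul t s m := by
    induction m using Quotient.inductionOn with
    | h p => exact congrArg (Quotient.mk A.toricSetoid) (Prod.ext (mul_assoc _ _ _) rfl)

/-- The orbit map `π : M(P, lam) → P`. -/
def orbitMap (A : RCharPair n) : A.Space → A.poly :=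
  Quotient.lift (s := A.toricSetoid) (fun p => p.2) (fun _ _ h => h.1)

/-- `M(P, lam)` is a toric manifold: `lam` is a characteristic function, and `M(P, lam)`, with its
quotient topology and its `Tⁿ`-action, is a closed smooth `2n`-dimensional manifold covered by
`Tⁿ`-invariant smooth charts in which the action is, up to an automorphism of `Tⁿ`, the standard
action on `ℂⁿ`, with orbit space `P` via `π`. -/
structure IsToricManifold (A : RCharPair n) : Prop where
  characteristic : A.IsCharacteristic
  compactSpace : CompactSpace A.Space
  t2Space : T2Space A.Space
  secondCountable : SecondCountableTopology A.Space
  exists_smooth : ∃ _ : ChartedSpace (Fin n → ℂ) A.Space,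
    IsManifold 𝓘(ℝ, Fin n → ℂ) ∞ A.Space ∧
    ∀ e ∈ atlas (Fin n → ℂ) A.Space,
      (∀ (t : Fin n → Circle), ∀ m ∈ e.source, t • m ∈ e.source) ∧
      ∃ ψ : (Fin n → Circle) ≃ₜ* (Fin n → Circle),
        ∀ (t : Fin n → Circle), ∀ m ∈ e.source,
          e (t • m) = fun j => (ψ t j : ℂ) * e m j
  isQuotientMap : Topology.IsQuotientMap A.orbitMap
  orbitMap_eq_iff : ∀ m m' : A.Space,
    A.orbitMap m = A.orbitMap m' ↔ ∃ t : Fin n → Circle, t • m = m'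

/-! ### Blowups -/

/-- `M(B)` is the blowup of `M(A)` along `π⁻¹(F)`, the face `F` being cut off by the hyperplane
`{l = c}`. -/
structure IsBlowup (A B : RCharPair n) (F : Set (Fin n → ℝ))
    (l : (Fin n → ℝ) →L[ℝ] ℝ) (c : ℝ) : Prop where
  isFace : IsFace A.poly F
  ne_zero : l ≠ 0
  pos_of_mem : ∀ v ∈ vertices A.poly, v ∈ F → c < l v
  neg_of_notMem : ∀ v ∈ vertices A.poly, v ∉ F → l v < c
  poly_eq : B.poly = A.poly ∩ {x | l x ≤ c}
  lam_eq : ∀ (G : A.Facet) (G' : B.Facet), G'.1 = G.1 ∩ B.poly → B.lam G' = A.lam G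

/-- `F` is maximal, for inclusion, among the faces with nontrivial local group. -/
def IsMaximalSingular (A : RCharPair n) (F : Set (Fin n → ℝ)) : Prop :=
  Maximal (fun G => IsFace A.poly G ∧ A.singOrder G ≠ 1) F

/-- The vertices of `B` on its facet `E` that arise from the vertex `b` of `A`: all facets of `A`
through such a vertex also pass through `b`. -/
def verticesOver (A B : RCharPair n) (E : B.Facet) (b : Fin n → ℝ) : Set (Fin n → ℝ) :=
  {w | w ∈ vertices B.poly ∧ w ∈ E.1 ∧ ∀ G : A.Facet, w ∈ G.1 → b ∈ G.1}

/-- One step `M(B) → M(A)` of the resolution. -/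
def IsResolutionStep (A B : RCharPair n) : Prop :=
  ∃ (F : Set (Fin n → ℝ)) (l : (Fin n → ℝ) →L[ℝ] ℝ) (c : ℝ),
    -- `B` is a blowup of `A` along a maximal singular face `F`
    A.IsMaximalSingular F ∧ IsBlowup A B F l c ∧
    -- the section of the polytope by the hyperplane is a facet `E` of `B`
    ∃ E : B.Facet, E.1 = A.poly ∩ {x | l x = c} ∧
    -- the facets containing `F` are `i 0, …, i (k - 1)`
    ∃ (k : ℕ) (i : Fin k → A.Facet), Function.Injective i ∧ Set.range i = {G | F ⊆ G.1} ∧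
    -- the vector of `E` is the primitive vector of a lattice point `∑ⱼ qⱼ λ(iⱼ)`, `0 < |qⱼ| < 1`
    (∃ (q : Fin k → ℚ) (v : Fin n → ℤ) (m : ℕ),
      (∀ j, 0 < |q j| ∧ |q j| < 1) ∧ v ≠ 0 ∧
      (∀ a, (v a : ℚ) = ∑ j, q j * (A.lam (i j) a : ℚ)) ∧
      0 < m ∧ v = m • B.lam E) ∧
    -- the vertices off `F` stay, with the same order
    vertices B.poly \ E.1 = vertices A.poly \ F ∧
    (∀ v ∈ vertices A.poly \ F, B.singOrder {v} = A.singOrder {v}) ∧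
    -- every vertex of `F` is replaced by `k` vertices on `E`, of strictly smaller order
    (∀ w ∈ vertices B.poly ∩ E.1,
      ∃! b, b ∈ vertices A.poly ∩ F ∧ w ∈ verticesOver A B E b) ∧
    ∀ b ∈ vertices A.poly ∩ F, (verticesOver A B E b).ncard = k ∧
      ∀ w ∈ verticesOver A B E b, B.singOrder {w} < A.singOrder {b}

end RCharPair

end ToricOrb

end

/-!
If the vectors of the facets through a face `F` do not generate all the lattice points of their real
span, there is a nonzero lattice point `∑ qⱼ λ(Fⱼ)` with `0 ≤ qⱼ < 1`, and the maximality of `F`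
forces `0 < qⱼ`. Cutting off `F` by a hyperplane and giving the new facet the primitive vector of
this point replaces every vertex of `F` by vertices at which one of the `λ(Fⱼ)` is exchanged for a
multiple of `∑ qⱼ λ(Fⱼ)`; by Cramer's rule this multiplies the order of the local group by a number
less than `1`. Hence the process stops, and it can only stop when all the vertex groups are trivial.
Then the vectors of the facets at any vertex form a basis of `ℤⁿ`, and polar coordinates with
squared radii the distances from these facets identify a neighbourhood in `M(P, λ)` with an open
subset of `ℂⁿ`.
-/

noncomputable section

open scoped Manifold ContDiff

open Filter Topology

namespace ToricOrb

/-! ### Polyhedra -/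

section LinearSystem

variable {ι E : Type*} [NormedAddCommGroup E] [NormedSpace ℝ E]

variable (ι E) in
/-- A system of linear inequalities `normal i x ≤ bound i`, thought of as an H-presentation of the
polyhedron of its solutions. -/
structure LinearSystem where
  /-- the outer normals, as continuous functionals -/
  normal : ι → E →L[ℝ] ℝ
  /-- the right-hand sides -/
  bound : ι → ℝ

theorem exists_extremePoint_isMaxOn {K : Set E} (hK : IsCompact K) (hne : K.Nonempty)
    (l : E →L[ℝ] ℝ) : ∃ v ∈ K.extremePoints ℝ, IsMaxOn l K v := by
  obtain ⟨z, hz, hmax⟩ := hK.exists_isMaxOn hne l.continuous.continuousOn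
  have hexp : IsExposed ℝ K (l.toExposed K) := ContinuousLinearMap.toExposed.isExposed
  obtain ⟨v, hv⟩ := (hexp.isCompact hK).extremePoints_nonempty ⟨z, hz, hmax⟩
  exact ⟨v, hexp.isExtreme.extremePoints_subset_extremePoints hv, (extremePoints_subset hv).2⟩

namespace LinearSystem

/-- The solution set. -/
def polyhedron (S : LinearSystem ι E) : Set E := {x | ∀ i, S.normal i x ≤ S.bound i}

/-- The indices of the inequalities which are active, i.e. equalities, at `x`. -/
def tight (S : LinearSystem ι E) (x : E) : Set ι := {i | S.normal i x = S.bound i}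

/-- The face on which all the inequalities in `J` are active (possibly empty). -/
def face (S : LinearSystem ι E) (J : Set ι) : Set E := {x ∈ S.polyhedron | J ⊆ S.tight x}

variable {S : LinearSystem ι E} {x y z d : E} {J K : Set ι} {F : Set E} {i : ι}

theorem mem_tight : i ∈ S.tight x ↔ S.normal i x = S.bound i := Iff.rfl

theorem mem_face_singleton : x ∈ S.face {i} ↔ x ∈ S.polyhedron ∧ i ∈ S.tight x := by
  simp [face]

theorem face_anti (h : J ⊆ K) : S.face K ⊆ S.face J := fun _ hx => ⟨hx.1, h.trans hx.2⟩

theorem normal_sub_eq_zero (hx : i ∈ S.tight x) (hy : i ∈ S.tight y) :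
    S.normal i (x - y) = 0 := by
  rw [map_sub, mem_tight.1 hx, mem_tight.1 hy, sub_self]

theorem lt_of_notMem_tight (hx : x ∈ S.polyhedron) (hi : i ∉ S.tight x) :
    S.normal i x < S.bound i :=
  lt_of_le_of_ne (hx i) hi

theorem polyhedron_eq_iInter (S : LinearSystem ι E) :
    S.polyhedron = ⋂ i, {x | S.normal i x ≤ S.bound i} := by
  ext x
  simp [polyhedron]

theorem isClosed_polyhedron (S : LinearSystem ι E) : IsClosed S.polyhedron :=
  S.polyhedron_eq_iInter ▸ isClosed_iInter fun i => isClosed_le (S.normal i).continuous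
    continuous_const

theorem convex_polyhedron (S : LinearSystem ι E) : Convex ℝ S.polyhedron :=
  S.polyhedron_eq_iInter ▸ convex_iInter fun i =>
    convex_halfSpace_le (S.normal i).toLinearMap.isLinear _

theorem tight_of_mem_openSegment (hx : x ∈ S.polyhedron) (hy : y ∈ S.polyhedron)
    (hz : z ∈ openSegment ℝ x y) : S.tight z = S.tight x ∩ S.tight y := by
  obtain ⟨s, t, hs, ht, hst, rfl⟩ := hz
  ext i
  simp only [Set.mem_inter_iff, mem_tight, map_add, map_smul, smul_eq_mul]
  have hx := hx i
  have hy := hy i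
  refine ⟨fun h => ⟨?_, ?_⟩, fun h => by rw [h.1, h.2, ← add_mul, hst, one_mul]⟩ <;>
    nlinarith [mul_le_mul_of_nonneg_left hx hs.le, mul_le_mul_of_nonneg_left hy ht.le,
      congrArg (· * S.bound i) hst]

theorem eventually_add_smul_mem_polyhedron [Finite ι] (hx : x ∈ S.polyhedron)
    (hd : ∀ i ∈ S.tight x, S.normal i d ≤ 0) :
    ∀ᶠ t : ℝ in 𝓝[>] 0, x + t • d ∈ S.polyhedron ∧
      S.tight (x + t • d) = {i ∈ S.tight x | S.normal i d = 0} := by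
  have key : ∀ i, ∀ᶠ t : ℝ in 𝓝[>] 0, S.normal i (x + t • d) ≤ S.bound i ∧
      (i ∈ S.tight (x + t • d) ↔ i ∈ S.tight x ∧ S.normal i d = 0) := by
    intro i
    by_cases hi : i ∈ S.tight x
    · filter_upwards [self_mem_nhdsWithin] with t (ht : 0 < t)
      have hid := mul_nonpos_of_nonneg_of_nonpos ht.le (hd i hi)
      simpa [mem_tight, mem_tight.1 hi, ht.ne'] using hid
    · have hlt : ∀ᶠ t : ℝ in 𝓝 0, S.normal i (x + t • d) < S.bound i :=
        ContinuousAt.eventually_lt (by fun_prop) continuousAt_const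
          (by simpa using lt_of_notMem_tight hx hi)
      filter_upwards [nhdsWithin_le_nhds hlt] with t ht
      exact ⟨ht.le, fun e => absurd e ht.ne, fun e => absurd e.1 hi⟩
  filter_upwards [eventually_all.2 key] with t ht
  exact ⟨fun i => (ht i).1, Set.ext fun i => (ht i).2⟩

theorem exists_add_smul_mem_polyhedron [Finite ι] (hx : x ∈ S.polyhedron)
    (hd : ∀ i ∈ S.tight x, S.normal i d ≤ 0) :
    ∃ t : ℝ, 0 < t ∧ x + t • d ∈ S.polyhedron ∧
      S.tight (x + t • d) = {i ∈ S.tight x | S.normal i d = 0} := by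
  obtain ⟨t, ht, ht0⟩ :=
    ((eventually_add_smul_mem_polyhedron hx hd).and self_mem_nhdsWithin).exists
  exact ⟨t, ht0, ht⟩

theorem isExposed_face_singleton (S : LinearSystem ι E) (i : ι) :
    IsExposed ℝ S.polyhedron (S.face {i}) := by
  rintro ⟨z, hz⟩
  rw [mem_face_singleton] at hz
  refine ⟨S.normal i, Set.ext fun x => mem_face_singleton.trans <| and_congr_right fun hx => ?_⟩
  exact ⟨fun hi y hy => (hy i).trans_eq (mem_tight.1 hi).symm,
    fun hmax => (hx i).antisymm ((mem_tight.1 hz.2).symm.trans_le (hmax z hz.1))⟩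

theorem isExposed_face [Finite ι] (S : LinearSystem ι E) (J : Set ι) :
    IsExposed ℝ S.polyhedron (S.face J) := by
  induction J, J.toFinite using Set.Finite.induction_on with
  | empty => simpa [face] using IsExposed.refl S.polyhedron
  | @insert i J _ _ ih =>
    have : S.face (insert i J) = S.face {i} ∩ S.face J := by
      ext x
      simp only [face, Set.insert_subset_iff, Set.singleton_subset_iff, Set.mem_inter_iff,
        Set.mem_ofPred_eq]
      tauto
    exact this ▸ (S.isExposed_face_singleton i).inter ih

/-- A point in the relative interior of a convex subset of the polyhedron has this property. -/
theorem exists_tight_eq_of_convex [Finite ι] (hF : F ⊆ S.polyhedron) (hc : Convex ℝ F)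
    (hne : F.Nonempty) : ∃ z ∈ F, S.tight z = {i | ∀ x ∈ F, i ∈ S.tight x} := by
  suffices h : ∀ J : Set ι, ∃ z ∈ F, ∀ i ∈ J, i ∈ S.tight z → ∀ x ∈ F, i ∈ S.tight x by
    obtain ⟨z, hz, hzt⟩ := h Set.univ
    exact ⟨z, hz, Set.ext fun i => ⟨hzt i trivial, fun hi => hi z hz⟩⟩
  intro J
  induction J, J.toFinite using Set.Finite.induction_on with
  | empty => exact ⟨hne.some, hne.some_mem, fun _ h => h.elim⟩
  | @insert i J _ _ ih =>
    obtain ⟨z, hz, hzJ⟩ := ih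
    by_cases hi : ∀ x ∈ F, i ∈ S.tight x
    · exact ⟨z, hz, Set.forall_mem_insert.2 ⟨fun _ => hi, hzJ⟩⟩
    push Not at hi
    obtain ⟨x, hx, hxi⟩ := hi
    have ht : S.tight (midpoint ℝ x z) = S.tight x ∩ S.tight z :=
      tight_of_mem_openSegment (hF hx) (hF hz) (midpoint_mem_openSegment x z)
    refine ⟨midpoint ℝ x z, hc.midpoint_mem hx hz, Set.forall_mem_insert.2 ⟨?_, ?_⟩⟩
    · exact fun h => absurd (ht.le h).1 hxi
    · exact fun j hj h => hzJ j hj (ht.le h).2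

theorem eq_face_of_isExposed [Finite ι] (hF : IsExposed ℝ S.polyhedron F) (hne : F.Nonempty) :
    F = S.face {i | ∀ x ∈ F, i ∈ S.tight x} := by
  obtain ⟨z, hz, hzt⟩ := exists_tight_eq_of_convex hF.subset (hF.convex S.convex_polyhedron) hne
  obtain ⟨l, rfl⟩ := hF hne
  refine Set.Subset.antisymm (fun x hx => ⟨hx.1, fun i hi => hi x hx⟩) fun x ⟨hx, hxt⟩ => ?_
  -- moving from `z` away from `x` stays in the polyhedron, so `l z > l x` is impossible
  obtain ⟨t, ht, hmem, -⟩ := exists_add_smul_mem_polyhedron (d := z - x) hz.1 fun i hi =>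
    (normal_sub_eq_zero hi (hxt (hzt ▸ hi))).le
  have hzx : l z ≤ l x := by
    have := hz.2 _ hmem
    simp only [map_add, map_smul, map_sub, smul_eq_mul] at this
    nlinarith
  exact ⟨hx, fun y hy => (hz.2 y hy).trans hzx⟩

theorem mem_extremePoints_iff [Finite ι] :
    x ∈ S.polyhedron.extremePoints ℝ ↔
      x ∈ S.polyhedron ∧ ∀ d, (∀ i ∈ S.tight x, S.normal i d = 0) → d = 0 := by
  constructor
  · refine fun hx => ⟨hx.1, fun d hd => ?_⟩
    have hpos := eventually_add_smul_mem_polyhedron (d := d) hx.1 fun i hi => (hd i hi).le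
    have hneg := eventually_add_smul_mem_polyhedron (d := -d) hx.1 fun i hi => by simp [hd i hi]
    obtain ⟨t, ⟨h₁, h₂⟩, ht⟩ := ((hpos.and hneg).and self_mem_nhdsWithin).exists
    have hmid : x ∈ openSegment ℝ (x + t • d) (x + t • -d) :=
      ⟨1 / 2, 1 / 2, by norm_num, by norm_num, by norm_num, by module⟩
    have := hx.2 h₁.1 h₂.1 hmid
    exact (smul_eq_zero.1 (add_eq_left.1 this)).resolve_left (ne_of_gt ht)
  · refine fun ⟨hx, hd⟩ => mem_extremePoints.2 ⟨hx, fun y hy z hz hxyz => ?_⟩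
    have ht := tight_of_mem_openSegment hy hz hxyz
    have eq_of_subset : ∀ y, S.tight x ⊆ S.tight y → y = x := fun y hxy =>
      sub_eq_zero.1 <| hd _ fun i hi => normal_sub_eq_zero (hxy hi) hi
    exact ⟨eq_of_subset y (ht.le.trans Set.inter_subset_left),
      eq_of_subset z (ht.le.trans Set.inter_subset_right)⟩

theorem eq_of_tight_subset [Finite ι] (hx : x ∈ S.polyhedron.extremePoints ℝ)
    (h : S.tight x ⊆ S.tight y) : y = x :=
  sub_eq_zero.1 <| (mem_extremePoints_iff.1 hx).2 _ fun _ hi => normal_sub_eq_zero (h hi) hi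

theorem face_tight_of_mem_extremePoints [Finite ι] (hx : x ∈ S.polyhedron.extremePoints ℝ) :
    S.face (S.tight x) = {x} :=
  Set.Subset.antisymm (fun _ hy => eq_of_tight_subset hx hy.2) <| by
    rintro _ rfl
    exact ⟨hx.1, subset_rfl⟩

theorem finite_extremePoints [Finite ι] (S : LinearSystem ι E) :
    (S.polyhedron.extremePoints ℝ).Finite :=
  Set.Finite.of_finite_image (Set.toFinite _) fun _ _ _ hy h => eq_of_tight_subset hy h.ge

theorem isCompact_polyhedron [ProperSpace E] (hb : Bornology.IsBounded S.polyhedron) :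
    IsCompact S.polyhedron :=
  Metric.isCompact_of_isClosed_isBounded S.isClosed_polyhedron hb

theorem exists_extremePoint_isMaxOn_face [Finite ι] [ProperSpace E]
    (hb : Bornology.IsBounded S.polyhedron) (hJ : (S.face J).Nonempty) (l : E →L[ℝ] ℝ) :
    ∃ v ∈ S.polyhedron.extremePoints ℝ, v ∈ S.face J ∧ IsMaxOn l (S.face J) v := by
  have hF := S.isExposed_face J
  obtain ⟨v, hv, hmax⟩ := exists_extremePoint_isMaxOn (hF.isCompact (isCompact_polyhedron hb)) hJ l
  exact ⟨v, hF.isExtreme.extremePoints_subset_extremePoints hv, hv.1, hmax⟩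

theorem convexHull_extremePoints [Finite ι] [ProperSpace E]
    (hb : Bornology.IsBounded S.polyhedron) :
    convexHull ℝ (S.polyhedron.extremePoints ℝ) = S.polyhedron := by
  have hclosed := (S.finite_extremePoints.isCompact_convexHull ℝ).isClosed
  exact hclosed.closure_eq.symm.trans
    (closure_convexHull_extremePoints (isCompact_polyhedron hb) S.convex_polyhedron)

end LinearSystem

end LinearSystem

section LinearAlgebra

theorem exists_forall_apply_eq {ι K V : Type*} [Finite ι] [Field K] [AddCommGroup V] [Module K V]
    {a : ι → Module.Dual K V} (h : LinearIndependent K a) (r : ι → K) : ∃ d, ∀ i, a i d = r i := by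
  classical
  have := Fintype.ofFinite ι
  suffices hs : Function.Surjective (LinearMap.pi a) from
    (hs r).imp fun d hd i => congrFun hd i
  refine LinearMap.dualMap_injective_iff.1 <|
    (injective_iff_map_eq_zero _).2 fun (f : Module.Dual K (ι → K)) hf => ?_
  have hsum : ∑ i, f (Pi.single i 1) • a i = 0 := by
    ext x
    have hx : f (LinearMap.pi a x) = 0 := LinearMap.congr_fun hf x
    rw [pi_eq_sum_univ' (LinearMap.pi a x)] at hx
    simpa [mul_comm] using hx
  refine LinearMap.pi_ext' fun i => LinearMap.ext_ring ?_
  simpa using Fintype.linearIndependent_iff.1 h _ hsum i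

theorem exists_forall_mem_apply_eq {ι E : Type*} [NormedAddCommGroup E] [NormedSpace ℝ E]
    {a : ι → E →L[ℝ] ℝ} {J : Set ι} [Finite J] (h : LinearIndepOn ℝ a J) (r : ι → ℝ) :
    ∃ d, ∀ i ∈ J, a i d = r i := by
  have h' : LinearIndependent ℝ fun i : J => (a i : E →ₗ[ℝ] ℝ) :=
    h.linearIndependent.map' (ContinuousLinearMap.coeLM ℝ)
      (LinearMap.ker_eq_bot.2 ContinuousLinearMap.coe_injective)
  obtain ⟨d, hd⟩ := exists_forall_apply_eq h' fun i => r i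
  exact ⟨d, fun i hi => hd ⟨i, hi⟩⟩

variable {E : Type*} [AddCommGroup E] [Module ℝ E] {F : Set E} {g : Module.Dual ℝ E} {c : ℝ}

theorem vectorSpan_le_ker (h : ∀ x ∈ F, g x = c) : vectorSpan ℝ F ≤ LinearMap.ker g := by
  rw [vectorSpan_def, Submodule.span_le]
  rintro _ ⟨x, hx, y, hy, rfl⟩
  simp [h x hx, h y hy]

theorem vectorSpan_eq_ker [FiniteDimensional ℝ E] (hg : g ≠ 0) (h : ∀ x ∈ F, g x = c)
    (hF : Module.finrank ℝ (vectorSpan ℝ F) + 1 = Module.finrank ℝ E) :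
    vectorSpan ℝ F = LinearMap.ker g :=
  Submodule.eq_of_le_of_finrank_eq (vectorSpan_le_ker h) <|
    Nat.succ_injective <| hF.trans (Module.Dual.finrank_ker_add_one_of_ne_zero hg).symm

end LinearAlgebra

theorem vectorSpan_eq_top_of_interior_nonempty {E : Type*} [NormedAddCommGroup E]
    [NormedSpace ℝ E] {P : Set E} (h : (interior P).Nonempty) : vectorSpan ℝ P = ⊤ := by
  rw [← direction_affineSpan, affineSpan_eq_top_of_nonempty_interior
    (h.mono (interior_mono (subset_convexHull ℝ P))), AffineSubspace.direction_top]

namespace LinearSystem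

/-- Full-dimensional polyhedra presented without superfluous inequalities: each one cuts out a
facet. -/
structure IsIrredundant {ι E : Type*} [NormedAddCommGroup E] [NormedSpace ℝ E]
    (S : LinearSystem ι E) : Prop where
  normal_ne_zero : ∀ i, S.normal i ≠ 0
  interior_nonempty : (interior S.polyhedron).Nonempty
  exists_tight_eq_singleton : ∀ i, ∃ x ∈ S.polyhedron, S.tight x = {i}

theorem IsIrredundant.face_singleton_injective {ι E : Type*} [NormedAddCommGroup E]
    [NormedSpace ℝ E] {S : LinearSystem ι E} (h : S.IsIrredundant) :
    Function.Injective fun i => S.face {i} := fun i j hij => by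
  obtain ⟨z, hz, hzt⟩ := h.exists_tight_eq_singleton i
  have : z ∈ S.face {j} := hij.le ⟨hz, hzt.ge⟩
  exact (hzt.le (mem_face_singleton.1 this).2).symm

section Facets

variable {ι E : Type*} [Finite ι] [NormedAddCommGroup E] [NormedSpace ℝ E]
  [FiniteDimensional ℝ E] {S : LinearSystem ι E} {F : Set E} {i : ι} {z : E}

theorem finrank_vectorSpan_face_singleton (hi : S.normal i ≠ 0) (hz : z ∈ S.polyhedron)
    (hzt : S.tight z = {i}) :
    Module.finrank ℝ (vectorSpan ℝ (S.face {i})) + 1 = Module.finrank ℝ E := by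
  have hi' : (S.normal i : E →ₗ[ℝ] ℝ) ≠ 0 := fun h => hi (ContinuousLinearMap.coe_injective h)
  suffices hs : vectorSpan ℝ (S.face {i}) = LinearMap.ker (S.normal i : E →ₗ[ℝ] ℝ) by
    rw [hs]
    exact Module.Dual.finrank_ker_add_one_of_ne_zero hi'
  refine le_antisymm (vectorSpan_le_ker fun x hx => hx.2 rfl) fun d (hd : S.normal i d = 0) => ?_
  obtain ⟨t, ht, hmem, htight⟩ := exists_add_smul_mem_polyhedron (d := d) hz (by simp [hzt, hd])
  have hmem' : z + t • d ∈ S.face {i} := ⟨hmem, by simp [htight, hzt, hd]⟩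
  have := vsub_mem_vectorSpan ℝ hmem' (show z ∈ S.face {i} from ⟨hz, hzt.ge⟩)
  rw [vsub_eq_sub, add_sub_cancel_left] at this
  exact (Submodule.smul_mem_iff _ ht.ne').1 this

namespace IsIrredundant

theorem exists_eq_face_singleton (h : S.IsIrredundant)
    (hF : IsExposed ℝ S.polyhedron F) (hne : F.Nonempty)
    (hdim : Module.finrank ℝ (vectorSpan ℝ F) + 1 = Module.finrank ℝ E) :
    ∃ i, F = S.face {i} := by
  obtain ⟨z, hz, hzt⟩ := exists_tight_eq_of_convex hF.subset (hF.convex S.convex_polyhedron) hne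
  have hFt := eq_face_of_isExposed hF hne
  rw [← hzt] at hFt
  obtain ⟨i, hi⟩ : (S.tight z).Nonempty := by
    refine Set.nonempty_iff_ne_empty.2 fun hem => ?_
    have : F = S.polyhedron := by simp [hFt, hem, face]
    rw [this, vectorSpan_eq_top_of_interior_nonempty h.interior_nonempty, finrank_top] at hdim
    exact Nat.succ_ne_self _ hdim
  refine ⟨i, Set.Subset.antisymm (hFt.le.trans (face_anti (by simpa using hi))) fun x hx => ?_⟩
  rw [mem_face_singleton] at hx
  have hspan : x - z ∈ vectorSpan ℝ F := by
    rw [vectorSpan_eq_ker (g := (S.normal i : E →ₗ[ℝ] ℝ)) (c := S.bound i)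
      (fun h₀ => h.normal_ne_zero i (ContinuousLinearMap.coe_injective h₀))
      (fun y hy => (hFt.le hy).2 hi) hdim]
    exact normal_sub_eq_zero hx.2 hi
  refine hFt.ge ⟨hx.1, fun j hj => ?_⟩
  have hker := vectorSpan_le_ker (g := (S.normal j : E →ₗ[ℝ] ℝ)) (c := S.bound j)
    (fun y hy => (hFt.le hy).2 hj) hspan
  simpa [sub_eq_zero, mem_tight.1 hj, mem_tight] using hker

end IsIrredundant

end Facets

/-- Irredundant systems whose solution set is a simple polytope: the active normals are linearly
independent at every point. -/
structure IsSimple {ι E : Type*} [NormedAddCommGroup E] [NormedSpace ℝ E] (S : LinearSystem ι E) :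
    Prop where
  isBounded : Bornology.IsBounded S.polyhedron
  nonempty : S.polyhedron.Nonempty
  indep : ∀ x ∈ S.polyhedron, LinearIndepOn ℝ S.normal (S.tight x)
  exists_mem_tight : ∀ i, ∃ x ∈ S.polyhedron, i ∈ S.tight x

namespace IsSimple

variable {ι E : Type*} [NormedAddCommGroup E] [NormedSpace ℝ E]
  {S : LinearSystem ι E} {x : E} {J K : Set ι}

theorem normal_ne_zero (h : S.IsSimple) (i : ι) : S.normal i ≠ 0 := by
  obtain ⟨x, hx, hi⟩ := h.exists_mem_tight i
  exact (h.indep x hx).ne_zero hi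

theorem face_singleton_nonempty (h : S.IsSimple) (i : ι) : (S.face {i}).Nonempty := by
  obtain ⟨x, hx, hi⟩ := h.exists_mem_tight i
  exact ⟨x, mem_face_singleton.2 ⟨hx, hi⟩⟩

variable [Finite ι]

theorem exists_tight_eq (h : S.IsSimple) (hx : x ∈ S.polyhedron) (hJ : J ⊆ S.tight x) :
    ∃ z ∈ S.polyhedron, S.tight z = J := by
  classical
  obtain ⟨d, hd⟩ := exists_forall_mem_apply_eq (h.indep x hx) fun i => if i ∈ J then 0 else -1
  obtain ⟨t, -, hmem, ht⟩ := exists_add_smul_mem_polyhedron (d := d) hx fun i hi => by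
    rw [hd i hi]
    split_ifs <;> norm_num
  refine ⟨_, hmem, ht.trans (Set.ext fun i => ?_)⟩
  constructor
  · rintro ⟨hi, hid⟩
    by_contra hiJ
    simp [hd i hi, hiJ] at hid
  · exact fun hi => ⟨hJ hi, by simp [hd i (hJ hi), hi]⟩

theorem interior_nonempty (h : S.IsSimple) : (interior S.polyhedron).Nonempty := by
  obtain ⟨x, hx⟩ := h.nonempty
  obtain ⟨z, hz, hzt⟩ := h.exists_tight_eq hx (Set.empty_subset _)
  refine ⟨z, mem_interior.2 ⟨⋂ i, {x | S.normal i x < S.bound i}, ?_, ?_, ?_⟩⟩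
  · exact fun y hy i => (Set.mem_iInter.1 hy i).le
  · exact isOpen_iInter_of_finite fun i => isOpen_lt (S.normal i).continuous continuous_const
  · exact Set.mem_iInter.2 fun i => lt_of_notMem_tight hz (by simp [hzt])

theorem face_subset_face_iff (h : S.IsSimple) (hJ : (S.face J).Nonempty) :
    S.face J ⊆ S.face K ↔ K ⊆ J := by
  refine ⟨fun hs => ?_, face_anti⟩
  obtain ⟨x, hx⟩ := hJ
  obtain ⟨z, hz, hzt⟩ := h.exists_tight_eq hx.1 hx.2
  exact hzt ▸ (hs ⟨hz, hzt.ge⟩).2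

theorem isIrredundant (h : S.IsSimple) : S.IsIrredundant where
  normal_ne_zero := h.normal_ne_zero
  interior_nonempty := h.interior_nonempty
  exists_tight_eq_singleton i := by
    obtain ⟨x, hx, hi⟩ := h.exists_mem_tight i
    exact h.exists_tight_eq hx (Set.singleton_subset_iff.2 hi)

variable [FiniteDimensional ℝ E]

theorem mem_extremePoints_iff_ncard_tight (h : S.IsSimple) :
    x ∈ S.polyhedron.extremePoints ℝ ↔
      x ∈ S.polyhedron ∧ (S.tight x).ncard = Module.finrank ℝ E := by
  have := Fintype.ofFinite (S.tight x)
  rw [mem_extremePoints_iff]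
  refine and_congr_right fun hx => ?_
  let φ : E →ₗ[ℝ] (S.tight x → ℝ) := LinearMap.pi fun i => S.normal i
  have hinj : (∀ d, (∀ i ∈ S.tight x, S.normal i d = 0) → d = 0) ↔ Function.Injective φ := by
    simp [injective_iff_map_eq_zero, funext_iff, φ]
  have hsurj : Function.Surjective φ := fun r => by
    obtain ⟨d, hd⟩ := exists_forall_mem_apply_eq (h.indep x hx) (Function.extend Subtype.val r 0)
    exact ⟨d, funext fun i => (hd i i.2).trans (Subtype.val_injective.extend_apply r 0 i)⟩
  have hcard : (S.tight x).ncard = Module.finrank ℝ (S.tight x → ℝ) := by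
    rw [Module.finrank_fintype_fun_eq_card, ← Nat.card_eq_fintype_card, Nat.card_coe_set_eq]
  rw [hinj, hcard]
  exact ⟨fun hi => (LinearEquiv.ofBijective φ ⟨hi, hsurj⟩).finrank_eq.symm,
    fun he => (LinearMap.injective_iff_surjective_of_finrank_eq_finrank he.symm).2 hsurj⟩

end IsSimple

section Polytope

variable {n : ℕ} {ι : Type*} [Finite ι] {S : LinearSystem ι (Fin n → ℝ)}

theorem isFace_face (S : LinearSystem ι (Fin n → ℝ)) {J : Set ι}
    (hJ : (S.face J).Nonempty) : IsFace S.polyhedron (S.face J) :=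
  ⟨S.isExposed_face J, hJ⟩

theorem vertices_polyhedron (S : LinearSystem ι (Fin n → ℝ)) :
    vertices S.polyhedron = S.polyhedron.extremePoints ℝ := by
  refine Set.Subset.antisymm (fun v hv => isExtreme_singleton.1 hv.1.isExtreme) fun v hv => ?_
  have := S.isFace_face (J := S.tight v) (by simp [face_tight_of_mem_extremePoints hv])
  rwa [face_tight_of_mem_extremePoints hv] at this

namespace IsIrredundant

theorem isFacet_face_singleton (h : S.IsIrredundant) (i : ι) :
    IsFacet S.polyhedron (S.face {i}) := by
  obtain ⟨z, hz, hzt⟩ := h.exists_tight_eq_singleton i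
  exact ⟨S.isFace_face ⟨z, hz, hzt.ge⟩,
    (finrank_vectorSpan_face_singleton (h.normal_ne_zero i) hz hzt).trans (by simp)⟩

/-- The bijection between the inequalities of an irredundant system and the facets. -/
def facetEquiv (h : S.IsIrredundant) : ι ≃ {F : Set (Fin n → ℝ) // IsFacet S.polyhedron F} :=
  Equiv.ofBijective (fun i => ⟨S.face {i}, h.isFacet_face_singleton i⟩)
    ⟨fun _ _ hij => h.face_singleton_injective (congrArg Subtype.val hij), fun ⟨_, hF, hdim⟩ => by
      obtain ⟨i, rfl⟩ := h.exists_eq_face_singleton hF.1 hF.2 (hdim.trans (by simp))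
      exact ⟨i, rfl⟩⟩

theorem coe_facetEquiv (h : S.IsIrredundant) (i : ι) :
    (h.facetEquiv i : Set (Fin n → ℝ)) = S.face {i} :=
  rfl

theorem ncard_facets (h : S.IsIrredundant) {x : Fin n → ℝ} (hx : x ∈ S.polyhedron) :
    {F | IsFacet S.polyhedron F ∧ x ∈ F}.ncard = (S.tight x).ncard := by
  symm
  refine Set.ncard_congr (fun i _ => S.face {i})
    (fun i hi => ⟨h.isFacet_face_singleton i, mem_face_singleton.2 ⟨hx, hi⟩⟩)
    (fun i j _ _ hij => h.face_singleton_injective hij) fun F ⟨hF, hvF⟩ => ?_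
  obtain ⟨i, hi⟩ := h.facetEquiv.surjective ⟨F, hF⟩
  obtain rfl : S.face {i} = F := congrArg Subtype.val hi
  exact ⟨i, (mem_face_singleton.1 hvF).2, rfl⟩

end IsIrredundant

theorem IsSimple.isSimplePolytope (h : S.IsSimple) : IsSimplePolytope S.polyhedron where
  exists_convexHull := ⟨S.finite_extremePoints.toFinset, by
    rw [Set.Finite.coe_toFinset, convexHull_extremePoints h.isBounded]⟩
  interior_nonempty := h.interior_nonempty
  ncard_facets v hv := by
    rw [S.vertices_polyhedron, h.mem_extremePoints_iff_ncard_tight, Module.finrank_fin_fun] at hv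
    rw [h.isIrredundant.ncard_facets hv.1, hv.2]

end Polytope

section Polar

variable {E : Type*} [NormedAddCommGroup E] [NormedSpace ℝ E] {V : Set E} {p x : E}
  {f g : E →L[ℝ] ℝ}

/-- The inequalities `f (y - p) ≤ 1` for `y ∈ V`, defining the polar of `V` with respect to `p` in
the dual space. -/
def polar (V : Set E) (p : E) : LinearSystem V (E →L[ℝ] ℝ) where
  normal y := ContinuousLinearMap.apply ℝ ℝ (y.1 - p)
  bound _ := 1

/-- The inequalities `f (x - p) ≤ 1` given by the nonzero vertices `f` of the polar of `V`. -/
def bipolar (V : Set E) (p : E) :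
    LinearSystem {f // f ∈ (polar V p).polyhedron.extremePoints ℝ ∧ f ≠ 0} E where
  normal f := f.1
  bound f := 1 + f.1 p

theorem finite_bipolar (hV : V.Finite) :
    Finite {f // f ∈ (polar V p).polyhedron.extremePoints ℝ ∧ f ≠ 0} :=
  have := hV.to_subtype
  ((polar V p).finite_extremePoints.subset fun _ hf => hf.1).to_subtype

theorem mem_tight_bipolar {f : {f // f ∈ (polar V p).polyhedron.extremePoints ℝ ∧ f ≠ 0}} :
    f ∈ (bipolar V p).tight x ↔ f.1 (x - p) = 1 := by
  rw [map_sub, sub_eq_iff_eq_add]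
  rfl

theorem apply_sub_le_one (hf : f ∈ (polar V p).polyhedron) (hx : x ∈ convexHull ℝ V) :
    f (x - p) ≤ 1 := by
  have hsub : convexHull ℝ V ⊆ {x | f x ≤ 1 + f p} := by
    refine convexHull_min (fun y hy => ?_) (convex_halfSpace_le f.toLinearMap.isLinear _)
    have : f (y - p) ≤ 1 := hf ⟨y, hy⟩
    rwa [map_sub, sub_le_iff_le_add] at this
  rw [map_sub, sub_le_iff_le_add]
  exact hsub hx

theorem isBounded_polyhedron_polar (hp : p ∈ interior (convexHull ℝ V)) :
    Bornology.IsBounded (polar V p).polyhedron := by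
  obtain ⟨r, hr, hball⟩ := Metric.nhds_basis_closedBall.mem_iff.1 (mem_interior_iff_mem_nhds.1 hp)
  refine isBounded_iff_forall_norm_le.2 ⟨1 / r, fun f hf => ?_⟩
  have hle : ∀ z ∈ Metric.closedBall (0 : E) r, f z ≤ 1 := fun z hz => by
    simpa using apply_sub_le_one hf (hball (show p + z ∈ Metric.closedBall p r by simpa using hz))
  refine f.opNorm_le_bound (by positivity)
    (LinearMap.bound_of_ball_bound' hr 1 f.toLinearMap fun z hz => abs_le.2 ⟨?_, hle z hz⟩)
  have := hle (-z) (by simpa using hz)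
  rw [map_neg] at this
  exact neg_le.1 this

theorem exists_extremePoint_polar_one_lt [FiniteDimensional ℝ E] (hV : V.Finite)
    (hp : p ∈ interior (convexHull ℝ V)) (hx : x ∉ convexHull ℝ V) :
    ∃ f ∈ (polar V p).polyhedron.extremePoints ℝ, 1 < f (x - p) := by
  have hcl : IsClosed (convexHull ℝ V) := (hV.isCompact_convexHull ℝ).isClosed
  obtain ⟨l, u, hlu, hux⟩ := geometric_hahn_banach_closed_point (convex_convexHull ℝ V) hcl hx
  have hpos : 0 < u - l p := sub_pos.2 (hlu p (interior_subset hp))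
  -- the separating functional, rescaled so as to lie in the polar
  have hg : (u - l p)⁻¹ • l ∈ (polar V p).polyhedron := fun y => by
    have := hlu y (subset_convexHull ℝ _ y.2)
    change (u - l p)⁻¹ * l (y - p) ≤ 1
    rw [map_sub, inv_mul_le_iff₀ hpos]
    linarith
  obtain ⟨f, hf, hmax⟩ := exists_extremePoint_isMaxOn
    (isCompact_polyhedron (isBounded_polyhedron_polar hp)) ⟨_, hg⟩
    (ContinuousLinearMap.apply ℝ ℝ (x - p))
  refine ⟨f, hf, lt_of_lt_of_le ?_ (hmax hg)⟩
  change 1 < (u - l p)⁻¹ * l (x - p)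
  rw [map_sub, lt_inv_mul_iff₀ hpos]
  linarith

theorem polyhedron_bipolar [FiniteDimensional ℝ E] (hV : V.Finite)
    (hp : p ∈ interior (convexHull ℝ V)) : (bipolar V p).polyhedron = convexHull ℝ V := by
  refine Set.Subset.antisymm (fun x hx => ?_) fun x hx f => ?_
  · by_contra hxV
    obtain ⟨f, hf, hlt⟩ := exists_extremePoint_polar_one_lt hV hp hxV
    have : f x ≤ 1 + f p := hx ⟨f, hf, by rintro rfl; simp at hlt; linarith⟩
    rw [map_sub] at hlt
    linarith
  · have := apply_sub_le_one f.2.1.1 hx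
    rwa [map_sub, sub_le_iff_le_add] at this

theorem eq_zero_of_mem_extremePoints_polar (hV : V.Finite)
    (hf : f ∈ (polar V p).polyhedron.extremePoints ℝ)
    (hg : ∀ y ∈ V, f (y - p) = 1 → g (y - p) = 0) : g = 0 := by
  have := hV.to_subtype
  exact (mem_extremePoints_iff.1 hf).2 g fun y hy => hg y y.2 hy

theorem isIrredundant_bipolar [FiniteDimensional ℝ E] (hV : V.Finite)
    (hp : p ∈ interior (convexHull ℝ V)) : (bipolar V p).IsIrredundant where
  normal_ne_zero f := f.2.2
  interior_nonempty := ⟨p, polyhedron_bipolar hV hp ▸ hp⟩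
  exists_tight_eq_singleton f := by
    have := finite_bipolar (p := p) hV
    have hmem : ∀ y ∈ V, f.1 (y - p) = 1 → y ∈ (bipolar V p).face {f} := fun y hy hty =>
      mem_face_singleton.2 ⟨polyhedron_bipolar hV hp ▸ subset_convexHull ℝ _ hy,
        mem_tight_bipolar.2 hty⟩
    have hne : ((bipolar V p).face {f}).Nonempty := by
      by_contra hem
      exact f.2.2 <| eq_zero_of_mem_extremePoints_polar hV f.2.1 fun y hy hty =>
        (hem ⟨y, hmem y hy hty⟩).elim
    have hexp := (bipolar V p).isExposed_face_singleton f
    obtain ⟨z, hz, hzt⟩ :=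
      exists_tight_eq_of_convex hexp.subset (hexp.convex (convex_polyhedron _)) hne
    refine ⟨z, hz.1, hzt.trans (Set.ext fun g => ⟨fun hg => ?_, ?_⟩)⟩
    · refine Subtype.ext (sub_eq_zero.1 ?_)
      refine eq_zero_of_mem_extremePoints_polar hV f.2.1 fun y hy hty => ?_
      have := mem_tight_bipolar.1 (hg y (hmem y hy hty))
      rw [_root_.sub_apply, this, hty, sub_self]
    · rintro rfl y hy
      exact hy.2 rfl

end Polar

section Simple

variable {ι κ E : Type*} [NormedAddCommGroup E] [NormedSpace ℝ E] {S : LinearSystem ι E}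

theorem IsIrredundant.isSimple [Finite ι] [FiniteDimensional ℝ E] (h : S.IsIrredundant)
    (hb : Bornology.IsBounded S.polyhedron)
    (hcard : ∀ v ∈ S.polyhedron.extremePoints ℝ, (S.tight v).ncard = Module.finrank ℝ E) :
    S.IsSimple where
  isBounded := hb
  nonempty := h.interior_nonempty.mono interior_subset
  exists_mem_tight i :=
    (h.exists_tight_eq_singleton i).imp fun _ hz => ⟨hz.1, hz.2.ge rfl⟩
  indep x hx := by
    obtain ⟨v, hv, hvx, -⟩ := exists_extremePoint_isMaxOn_face hb ⟨x, hx, subset_rfl⟩ 0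
    suffices hS : LinearIndepOn ℝ S.normal (S.tight v) from hS.mono hvx.2
    -- the `dim E` active normals at the vertex `v` have no common zero, so they span
    have := Fintype.ofFinite (S.tight v)
    let a : S.tight v → Module.Dual ℝ E := fun i => S.normal i
    suffices ha : LinearIndependent ℝ a from
      LinearIndependent.of_comp (ContinuousLinearMap.coeLM ℝ) ha
    refine linearIndependent_of_top_le_span_of_card_eq_finrank (fun g _ => ?_) ?_
    · refine mem_span_of_iInf_ker_le_ker fun d hd => ?_
      have : d = 0 := (mem_extremePoints_iff.1 hv).2 d fun i hi =>
        (Submodule.mem_iInf _).1 hd ⟨i, hi⟩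
      simp [this]
    · rw [← Nat.card_eq_fintype_card, Nat.card_coe_set_eq, hcard v hv, Subspace.dual_finrank_eq]

/-- Renaming the inequalities. -/
def reindex (S : LinearSystem ι E) (e : κ ≃ ι) : LinearSystem κ E where
  normal k := S.normal (e k)
  bound k := S.bound (e k)

theorem polyhedron_reindex (S : LinearSystem ι E) (e : κ ≃ ι) :
    (S.reindex e).polyhedron = S.polyhedron :=
  Set.ext fun x => e.forall_congr_right (q := fun i => S.normal i x ≤ S.bound i)

theorem tight_reindex (S : LinearSystem ι E) (e : κ ≃ ι) (x : E) :
    (S.reindex e).tight x = e ⁻¹' S.tight x := rfl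

theorem IsSimple.reindex (h : S.IsSimple) (e : κ ≃ ι) : (S.reindex e).IsSimple where
  isBounded := S.polyhedron_reindex e ▸ h.isBounded
  nonempty := S.polyhedron_reindex e ▸ h.nonempty
  exists_mem_tight k := S.polyhedron_reindex e ▸ h.exists_mem_tight (e k)
  indep x hx := by
    rw [S.polyhedron_reindex e] at hx
    have : (S.reindex e).normal = S.normal ∘ e := rfl
    rw [this, linearIndepOn_equiv, tight_reindex, Set.image_preimage_eq _ e.surjective]
    exact h.indep x hx

end Simple

end LinearSystem

theorem IsSimplePolytope.exists_system {n : ℕ} {P : Set (Fin n → ℝ)} (hP : IsSimplePolytope P) :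
    Finite {F // IsFacet P F} ∧ ∃ S : LinearSystem {F // IsFacet P F} (Fin n → ℝ),
      S.IsSimple ∧ S.polyhedron = P ∧ ∀ F, S.face {F} = F.1 := by
  obtain ⟨⟨V, rfl⟩, ⟨p, hp⟩, hfacets⟩ := hP
  let B := LinearSystem.bipolar (V : Set (Fin n → ℝ)) p
  have := LinearSystem.finite_bipolar (p := p) V.finite_toSet
  have hB : B.polyhedron = convexHull ℝ V := LinearSystem.polyhedron_bipolar V.finite_toSet hp
  have hirr : B.IsIrredundant := LinearSystem.isIrredundant_bipolar V.finite_toSet hp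
  rw [← hB] at hfacets ⊢
  have hsimple : B.IsSimple := by
    refine hirr.isSimple (hB ▸ (V.finite_toSet.isCompact_convexHull ℝ).isBounded) fun v hv => ?_
    rw [← hirr.ncard_facets hv.1, Module.finrank_fin_fun]
    exact hfacets v (B.vertices_polyhedron ▸ hv)
  refine ⟨.of_equiv _ hirr.facetEquiv, B.reindex hirr.facetEquiv.symm, hsimple.reindex _,
    B.polyhedron_reindex _, fun F => ?_⟩
  obtain ⟨i, rfl⟩ := hirr.facetEquiv.surjective F
  ext x
  rw [LinearSystem.mem_face_singleton, B.polyhedron_reindex, B.tight_reindex,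
    LinearSystem.IsIrredundant.coe_facetEquiv, LinearSystem.mem_face_singleton]
  simp

/-! ### Indices of lattices -/

section Lattice

variable {n : ℕ}

/-- The order of `((⟨V⟩ ⊗ ℝ) ∩ ℤⁿ) / ⟨V⟩`, which is the local group of a face when `V` consists of
the vectors of the facets containing it; `0` if the quotient is infinite. -/
def saturationIndex (V : Set (Fin n → ℤ)) : ℕ :=
  Nat.card (saturation V ⧸ (Submodule.span ℤ V).comap (saturation V).subtype)

theorem saturationIndex_eq_one_iff {V : Set (Fin n → ℤ)} :
    saturationIndex V = 1 ↔ saturation V ≤ Submodule.span ℤ V := by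
  rw [saturationIndex, Nat.card_eq_one_iff_unique, Submodule.Quotient.subsingleton_iff,
    Submodule.comap_subtype_eq_top]
  exact and_iff_left ⟨0⟩

section Rational

variable {κ : Type*} {u : κ → Fin n → ℤ} {v : Fin n → ℤ}

theorem mem_span_rat_of_mem_saturation (hu : LinearIndependent ℤ u)
    (hv : v ∈ saturation (Set.range u)) :
    algebraMap ℤ ℚ ∘ v ∈ Submodule.span ℚ (Set.range fun i => algebraMap ℤ ℚ ∘ u i) := by
  -- otherwise `v` and the `u i` are independent over `ℚ`, hence over `ℤ` and over `ℝ`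
  by_contra hnot
  let w : Option κ → Fin n → ℤ := fun o => o.casesOn' v u
  have hQ : LinearIndependent ℚ fun o => algebraMap ℤ ℚ ∘ w o :=
    linearIndependent_option.2 ⟨linearIndependent_algebraMap_comp_iff.2 hu, hnot⟩
  have hR : LinearIndependent ℝ fun o => algebraMap ℤ ℝ ∘ w o :=
    linearIndependent_algebraMap_comp_iff.2 (linearIndependent_algebraMap_comp_iff.1 hQ)
  refine (linearIndependent_option.1 hR).2 ?_
  rw [saturation, ← Set.range_comp] at hv
  exact hv

variable [Fintype κ]

theorem exists_rat_of_mem_saturation (hu : LinearIndependent ℤ u)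
    (hv : v ∈ saturation (Set.range u)) :
    ∃ q : κ → ℚ, ∀ a, (v a : ℚ) = ∑ i, q i * u i a := by
  obtain ⟨q, hq⟩ := (Submodule.mem_span_range_iff_exists_fun ℚ).1
    (mem_span_rat_of_mem_saturation hu hv)
  exact ⟨q, fun a => by simpa using (congrFun hq a).symm⟩

theorem mem_saturation_of_rat (q : κ → ℚ) (hq : ∀ a, (v a : ℚ) = ∑ i, q i * u i a) :
    v ∈ saturation (Set.range u) := by
  have hv : intCast n v = ∑ i, (q i : ℝ) • intCast n (u i) := by
    ext a
    have := congrArg (Rat.cast : ℚ → ℝ) (hq a)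
    push_cast at this
    simpa [intCast] using this
  change intCast n v ∈ Submodule.span ℝ (intCast n '' Set.range u)
  rw [hv, ← Set.range_comp]
  exact Submodule.sum_smul_mem _ _ fun i _ => Submodule.subset_span ⟨i, rfl⟩

theorem exists_sum_fract_notMem_span (hu : LinearIndependent ℤ u)
    (hsing : saturationIndex (Set.range u) ≠ 1) :
    ∃ (q : κ → ℚ) (v : Fin n → ℤ), (∀ j, 0 ≤ q j ∧ q j < 1) ∧
      v ∉ Submodule.span ℤ (Set.range u) ∧ ∀ a, (v a : ℚ) = ∑ j, q j * u j a := by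
  rw [Ne, saturationIndex_eq_one_iff] at hsing
  obtain ⟨w, hw, hws⟩ := Set.not_subset.1 hsing
  obtain ⟨r, hr⟩ := exists_rat_of_mem_saturation hu hw
  have hfloor : ∑ j, ⌊r j⌋ • u j ∈ Submodule.span ℤ (Set.range u) :=
    Submodule.sum_smul_mem _ _ fun j _ => Submodule.subset_span ⟨j, rfl⟩
  refine ⟨fun j => Int.fract (r j), w - ∑ j, ⌊r j⌋ • u j,
    fun j => ⟨Int.fract_nonneg _, Int.fract_lt_one _⟩, fun h => hws ?_, fun a => ?_⟩
  · simpa using add_mem h hfloor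
  · simp only [Pi.sub_apply, Int.cast_sub, hr a, Finset.sum_apply, Pi.smul_apply, smul_eq_mul,
      Int.cast_sum, Int.cast_mul, ← Finset.sum_sub_distrib, Int.fract, sub_mul]

theorem exists_latticePoint_of_minimal (hu : LinearIndependent ℤ u)
    (hsing : saturationIndex (Set.range u) ≠ 1)
    (hmin : ∀ J : Set κ, J ≠ Set.univ → saturationIndex (u '' J) = 1) :
    ∃ (q : κ → ℚ) (v : Fin n → ℤ), (∀ j, 0 < q j ∧ q j < 1) ∧ v ≠ 0 ∧
      ∀ a, (v a : ℚ) = ∑ j, q j * u j a := by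
  classical
  obtain ⟨q, v, hq, hv, hvq⟩ := exists_sum_fract_notMem_span hu hsing
  refine ⟨q, v, fun j => ⟨(hq j).1.lt_of_ne' fun h0 => hv ?_, (hq j).2⟩,
    fun h0 => hv (h0 ▸ zero_mem _), hvq⟩
  -- if `q j = 0` then `v` lies in the saturation of the other vectors, hence in their span
  have hJ : ({j}ᶜ : Set κ) ≠ Set.univ := by simp
  refine Submodule.span_mono (Set.image_subset_range u {j}ᶜ)
    (saturationIndex_eq_one_iff.1 (hmin _ hJ) ?_)
  rw [Set.image_eq_range]
  refine mem_saturation_of_rat (fun i => q i) fun a => (hvq a).trans ?_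
  refine (Fintype.sum_of_injective _ Subtype.val_injective _ _ (fun i hi => ?_) fun _ => rfl).symm
  obtain rfl : i = j := by simpa using hi
  rw [h0, zero_mul]

end Rational

theorem exists_nsmul_isPrimitiveVec {v : Fin n → ℤ} (hv : v ≠ 0) :
    ∃ (m : ℕ) (w : Fin n → ℤ), 0 < m ∧ IsPrimitiveVec w ∧ v = m • w := by
  obtain ⟨i₀, hi₀⟩ := Function.ne_iff.1 hv
  obtain ⟨g, hg, hg1⟩ := Finset.extract_gcd v (s := Finset.univ) ⟨i₀, Finset.mem_univ _⟩
  set d := Finset.univ.gcd v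
  have hd : 0 < d := Int.lt_iff_le_and_ne.2 ⟨Int.nonneg_of_normalize_eq_self
    Finset.normalize_gcd, fun h0 => hi₀ (by simpa [← h0] using hg i₀ (Finset.mem_univ _))⟩
  refine ⟨d.toNat, g, by simpa using hd, fun k hk => isUnit_of_dvd_one ?_, funext fun i => ?_⟩
  · exact hg1 ▸ Finset.dvd_gcd fun i _ => hk i
  · simp [hg i (Finset.mem_univ _), hd.le]

theorem exists_isPrimitiveVec_of_minimal {κ : Type*} [Fintype κ] {u : κ → Fin n → ℤ}
    (hu : LinearIndependent ℤ u) (hsing : saturationIndex (Set.range u) ≠ 1)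
    (hmin : ∀ J : Set κ, J ≠ Set.univ → saturationIndex (u '' J) = 1) :
    ∃ (q : κ → ℚ) (w : Fin n → ℤ), (∀ j, 0 < q j ∧ q j < 1) ∧ IsPrimitiveVec w ∧
      ∀ a, (w a : ℚ) = ∑ j, q j * u j a := by
  obtain ⟨q, v, hq, hv, hvq⟩ := exists_latticePoint_of_minimal hu hsing hmin
  obtain ⟨m, w, hm, hw, rfl⟩ := exists_nsmul_isPrimitiveVec hv
  have hm' : (0 : ℚ) < m := Nat.cast_pos.2 hm
  refine ⟨fun j => q j / m, w, fun j => ⟨div_pos (hq j).1 hm',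
    (div_lt_one hm').2 ((hq j).2.trans_le (Nat.one_le_cast.2 hm))⟩, hw, fun a => ?_⟩
  simp only [div_mul_eq_mul_div, ← Finset.sum_div, ← hvq]
  simp [hm'.ne']

theorem IsPrimitiveVec.den_eq_one {u v : Fin n → ℤ} (hu : IsPrimitiveVec u) {q : ℚ}
    (hv : ∀ a, (v a : ℚ) = q * u a) : q.den = 1 := by
  suffices IsUnit (q.den : ℤ) by simpa using Int.isUnit_iff_natAbs_eq.1 this
  refine hu _ fun a => ?_
  have hcross : q.num * u a = q.den * v a := by
    have : (q.num : ℚ) * u a = q.den * v a := by rw [hv a, ← mul_assoc, Rat.den_mul_eq_num]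
    exact_mod_cast this
  exact (Int.isCoprime_iff_gcd_eq_one.2
    (by simpa [Int.gcd, Nat.Coprime] using q.reduced.symm)).dvd_of_dvd_mul_left ⟨_, hcross⟩

theorem det_ne_zero_iff_linearIndependent_rows {m R : Type*} [Fintype m] [DecidableEq m]
    [CommRing R] [IsDomain R] {M : Matrix m m R} :
    M.det ≠ 0 ↔ LinearIndependent R fun i => M i := by
  refine ⟨Matrix.linearIndependent_rows_of_det_ne_zero, fun hM h0 => ?_⟩
  obtain ⟨c, hc, hc0⟩ := Matrix.exists_vecMul_eq_zero_iff.2 h0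
  rw [Matrix.vecMul_eq_sum] at hc0
  exact hc (funext (Fintype.linearIndependent_iff.1 hM c hc0))

theorem cast_det_updateRow {m : Type*} [Fintype m] [DecidableEq m] (M : Matrix m m ℤ) {w : m → ℤ}
    {r : m → ℚ} (hw : ∀ a, (w a : ℚ) = ∑ i, r i * M i a) (j : m) :
    ((M.updateRow j w).det : ℚ) = r j * M.det := by
  have hcast : ((M.updateRow j w).map (Int.cast : ℤ → ℚ)) =
      (M.map Int.cast).updateRow j (∑ i, r i • (M.map Int.cast) i) := by
    rw [Matrix.map_updateRow]
    congr 1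
    ext a
    simp [hw]
  rw [Int.cast_det, Int.cast_det, hcast, Matrix.det_updateRow_sum, smul_eq_mul]

theorem saturation_range_eq_top {u : Fin n → Fin n → ℤ} (hu : LinearIndependent ℤ u) :
    saturation (Set.range u) = ⊤ := by
  refine eq_top_iff.2 fun v _ => ?_
  have hR : LinearIndependent ℝ fun i => algebraMap ℤ ℝ ∘ u i :=
    linearIndependent_algebraMap_comp_iff.2 hu
  change intCast n v ∈ Submodule.span ℝ (intCast n '' Set.range u)
  rw [← Set.range_comp]
  exact (hR.span_eq_top_of_card_eq_finrank' (by simp)).ge trivial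

theorem saturationIndex_range {u : Fin n → Fin n → ℤ} (hu : LinearIndependent ℤ u) :
    saturationIndex (Set.range u) = (Matrix.of u).det.natAbs := by
  let e : saturation (Set.range u) ≃ₗ[ℤ] (Fin n → ℤ) :=
    LinearEquiv.ofTop _ (saturation_range_eq_top hu)
  have he : ((Submodule.span ℤ (Set.range u)).comap (saturation (Set.range u)).subtype).map
      (e : _ →ₗ[ℤ] _) = Submodule.span ℤ (Set.range u) :=
    Submodule.map_comap_eq_of_surjective e.surjective _
  rw [saturationIndex, Nat.card_congr (Submodule.Quotient.equiv _ _ e he).toEquiv,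
    ← Submodule.natAbs_det_basis_change (Pi.basisFun ℤ (Fin n)) _ (Module.Basis.span hu),
    Pi.basisFun_det]
  congr 2
  ext i : 1
  exact congrArg Subtype.val (Module.Basis.span_apply hu i)

section Exchange

variable {ι : Type*} [Fintype ι] {u : ι → Fin n → ℤ}

theorem saturationIndex_pos (hcard : Fintype.card ι = n) (hu : LinearIndependent ℤ u) :
    0 < saturationIndex (Set.range u) := by
  let e : Fin n ≃ ι := (Fintype.equivFinOfCardEq hcard).symm
  rw [← e.surjective.range_comp, saturationIndex_range (hu.comp e e.injective)]
  exact Int.natAbs_pos.2 (det_ne_zero_iff_linearIndependent_rows.2 (hu.comp e e.injective))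

variable [DecidableEq ι] {w : Fin n → ℤ} {r : ι → ℚ} {j : ι}

theorem linearIndependent_update_and_saturationIndex (hcard : Fintype.card ι = n)
    (hu : LinearIndependent ℤ u) (hw : ∀ a, (w a : ℚ) = ∑ i, r i * u i a) (hj : r j ≠ 0) :
    LinearIndependent ℤ (Function.update u j w) ∧
      (saturationIndex (Set.range (Function.update u j w)) : ℚ) =
        |r j| * saturationIndex (Set.range u) := by
  let e : Fin n ≃ ι := (Fintype.equivFinOfCardEq hcard).symm
  let M : Matrix (Fin n) (Fin n) ℤ := Matrix.of (u ∘ e)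
  have hM : LinearIndependent ℤ (u ∘ e) := hu.comp e e.injective
  have hupd : Function.update u j w ∘ e = M.updateRow (e.symm j) w :=
    Function.update_comp_equiv u e j w
  have hdet : ((M.updateRow (e.symm j) w).det : ℚ) = r j * M.det := by
    rw [cast_det_updateRow (r := r ∘ e) M fun a => (hw a).trans (e.sum_comp _).symm]
    simp
  have hind : LinearIndependent ℤ (Function.update u j w ∘ e) := by
    rw [hupd]
    refine det_ne_zero_iff_linearIndependent_rows.1 fun h0 => ?_
    rw [h0, Int.cast_zero, zero_eq_mul, Int.cast_eq_zero] at hdet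
    exact hdet.elim hj (det_ne_zero_iff_linearIndependent_rows.2 hM)
  refine ⟨(linearIndependent_equiv e).1 hind, ?_⟩
  rw [← e.surjective.range_comp, ← e.surjective.range_comp u, saturationIndex_range hind,
    saturationIndex_range hM, hupd, Nat.cast_natAbs, Nat.cast_natAbs, Int.cast_abs, Int.cast_abs,
    ← abs_mul, ← hdet]
  rfl

end Exchange

end Lattice

/-! ### Cutting off a face -/

theorem exists_mem_openSegment_apply_eq {E : Type*} [NormedAddCommGroup E] [NormedSpace ℝ E]
    {l : E →L[ℝ] ℝ} {c : ℝ} {x y : E} (hx : l x < c) (hy : c < l y) :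
    ∃ z ∈ openSegment ℝ x y, l z = c := by
  have hc : c ∈ openSegment ℝ (l x) (l y) := by
    rw [openSegment_eq_Ioo (hx.trans hy)]
    exact ⟨hx, hy⟩
  exact (image_openSegment ℝ (l : E →ₗ[ℝ] ℝ).toAffineMap x y).ge hc

namespace LinearSystem

section Cut

variable {ι E : Type*} [NormedAddCommGroup E] [NormedSpace ℝ E]

/-- The system `S` together with the inequality `l x ≤ c`, which gets the index `none`. -/
def cut (S : LinearSystem ι E) (l : E →L[ℝ] ℝ) (c : ℝ) : LinearSystem (Option ι) E where
  normal o := o.elim l S.normal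
  bound o := o.elim c S.bound

/-- The hyperplane `l = c` separates the vertices of the face `S.face J`, which is nonempty and of
codimension at least two, from the other vertices. -/
structure CutsOff (S : LinearSystem ι E) (J : Set ι) (l : E →L[ℝ] ℝ) (c : ℝ) : Prop where
  nonempty : (S.face J).Nonempty
  nontrivial : J.Nontrivial
  pos_of_mem : ∀ v ∈ S.polyhedron.extremePoints ℝ, v ∈ S.face J → c < l v
  neg_of_notMem : ∀ v ∈ S.polyhedron.extremePoints ℝ, v ∉ S.face J → l v < c

variable {S : LinearSystem ι E} {J K : Set ι} {l : E →L[ℝ] ℝ} {c : ℝ} {v w x : E}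

theorem polyhedron_cut (S : LinearSystem ι E) (l : E →L[ℝ] ℝ) (c : ℝ) :
    (S.cut l c).polyhedron = S.polyhedron ∩ {x | l x ≤ c} := by
  ext x
  exact Option.forall.trans and_comm

theorem face_cut_some (S : LinearSystem ι E) (l : E →L[ℝ] ℝ) (c : ℝ) (i : ι) :
    (S.cut l c).face {some i} = S.face {i} ∩ (S.cut l c).polyhedron := by
  ext x
  rw [mem_face_singleton, Set.mem_inter_iff, mem_face_singleton, polyhedron_cut]
  exact ⟨fun h => ⟨⟨h.1.1, h.2⟩, h.1⟩, fun h => ⟨h.2, h.1.2⟩⟩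

theorem face_cut_none (S : LinearSystem ι E) (l : E →L[ℝ] ℝ) (c : ℝ) :
    (S.cut l c).face {none} = S.polyhedron ∩ {x | l x = c} := by
  ext x
  rw [mem_face_singleton, polyhedron_cut]
  exact ⟨fun h => ⟨h.1.1, h.2⟩, fun h => ⟨⟨h.1, h.2.le⟩, h.2⟩⟩

theorem tight_cut_of_ne (hx : l x ≠ c) : (S.cut l c).tight x = some '' S.tight x := by
  ext (_ | i) <;> simp [cut, mem_tight, hx]

theorem tight_cut_of_eq (hx : l x = c) :
    (S.cut l c).tight x = insert none (some '' S.tight x) := by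
  ext (_ | i) <;> simp [cut, mem_tight, hx]

theorem ncard_tight_cut_of_ne (hx : l x ≠ c) :
    ((S.cut l c).tight x).ncard = (S.tight x).ncard := by
  rw [tight_cut_of_ne hx, Set.ncard_image_of_injective _ (Option.some_injective _)]

theorem ncard_tight_cut_of_eq [Finite ι] (hx : l x = c) :
    ((S.cut l c).tight x).ncard = (S.tight x).ncard + 1 := by
  rw [tight_cut_of_eq hx, Set.ncard_insert_of_notMem (by simp) (Set.toFinite _),
    Set.ncard_image_of_injective _ (Option.some_injective _)]

theorem smul_sub_eq_smul_sub_of_mem_extremePoints_cut [Finite ι] {u : E}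
    (hw : w ∈ (S.cut l c).polyhedron.extremePoints ℝ)
    (hlw : l w = c) (hu : S.tight w ⊆ S.tight u) (hv : S.tight w ⊆ S.tight v) :
    (l u - c) • (v - w) = (l v - c) • (u - w) := by
  refine sub_eq_zero.1 ((mem_extremePoints_iff.1 hw).2 _ (Option.forall.2 ⟨fun _ => ?_, ?_⟩))
  · change l _ = 0
    simp only [map_sub, map_smul, smul_eq_mul, hlw]
    ring
  · intro i hi
    change S.normal i _ = 0
    rw [map_sub, map_smul, map_smul, normal_sub_eq_zero (hv hi) hi, normal_sub_eq_zero (hu hi) hi,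
      smul_zero, smul_zero, sub_zero]

namespace CutsOff

theorem apply_ne (hc : S.CutsOff J l c) (hv : v ∈ S.polyhedron.extremePoints ℝ) : l v ≠ c := by
  by_cases hvJ : v ∈ S.face J
  · exact (hc.pos_of_mem v hv hvJ).ne'
  · exact (hc.neg_of_notMem v hv hvJ).ne

theorem mem_face_of_le (hc : S.CutsOff J l c) (hv : v ∈ S.polyhedron.extremePoints ℝ)
    (hl : c ≤ l v) : v ∈ S.face J :=
  not_imp_comm.1 (hc.neg_of_notMem v hv) hl.not_gt

end CutsOff

section FiniteDimensional

variable [Finite ι] [FiniteDimensional ℝ E]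

theorem IsSimple.exists_extremePoint_notMem_face (h : S.IsSimple) (hK : (S.face K).Nonempty)
    (hJK : ¬J ⊆ K) :
    ∃ v ∈ S.polyhedron.extremePoints ℝ, v ∈ S.face K ∧ v ∉ S.face J := by
  obtain ⟨j, hj, hjK⟩ := Set.not_subset.1 hJK
  obtain ⟨v, hv, hvK, hmax⟩ := exists_extremePoint_isMaxOn_face h.isBounded hK (-S.normal j)
  refine ⟨v, hv, hvK, fun hvJ => hjK ?_⟩
  obtain ⟨x, hx⟩ := hK
  obtain ⟨z, hz, rfl⟩ := h.exists_tight_eq hx.1 hx.2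
  exact (hz j).antisymm ((mem_tight.1 (hvJ.2 hj)).symm.trans_le
    (neg_le_neg_iff.1 (hmax ⟨hz, subset_rfl⟩)))

theorem IsSimple.ncard_tight_le (h : S.IsSimple) (hx : x ∈ S.polyhedron) :
    (S.tight x).ncard ≤ Module.finrank ℝ E := by
  have := Fintype.ofFinite (S.tight x)
  have hle := (h.indep x hx).linearIndependent.fintype_card_le_finrank
  rwa [← Nat.card_eq_fintype_card, Nat.card_coe_set_eq,
    ← (LinearMap.toContinuousLinearMap (𝕜 := ℝ) (E := E) (F' := ℝ)).finrank_eq,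
    Subspace.dual_finrank_eq] at hle

namespace CutsOff

theorem lt_of_mem_face (hc : S.CutsOff J l c) (h : S.IsSimple) (hx : x ∈ S.face J) :
    c < l x := by
  obtain ⟨v, hv, hvJ, hmax⟩ := exists_extremePoint_isMaxOn_face h.isBounded ⟨x, hx⟩ (-l)
  exact (hc.pos_of_mem v hv hvJ).trans_le (neg_le_neg_iff.1 (hmax hx))

theorem exists_extremePoint_notMem_face (hc : S.CutsOff J l c) (h : S.IsSimple)
    (hK : (S.face K).Nonempty) (hJK : ¬J ⊆ K) :
    ∃ v ∈ S.polyhedron.extremePoints ℝ, v ∈ S.face K ∧ l v < c := by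
  obtain ⟨v, hv, hvK, hvJ⟩ := h.exists_extremePoint_notMem_face hK hJK
  exact ⟨v, hv, hvK, hc.neg_of_notMem v hv hvJ⟩

theorem notMem_span (hc : S.CutsOff J l c) (h : S.IsSimple) (hx : x ∈ S.polyhedron)
    (hlx : l x = c) : l ∉ Submodule.span ℝ (S.normal '' S.tight x) := by
  -- a functional in this span is constant on the face of `x`, which contains a vertex
  intro hl
  obtain ⟨v, hv, hvx, -⟩ := exists_extremePoint_isMaxOn_face h.isBounded ⟨x, hx, subset_rfl⟩ l
  refine hc.apply_ne hv (Eq.trans ?_ hlx)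
  refine Submodule.span_induction (p := fun g _ => g v = g x) ?_ rfl ?_ ?_ hl
  · rintro _ ⟨i, hi, rfl⟩
    exact (mem_tight.1 (hvx.2 hi)).trans (mem_tight.1 hi).symm
  · intro g g' _ _ hg hg'
    simp [hg, hg']
  · intro r g _ hg
    simp [hg]

theorem linearIndepOn_normal_cut (hc : S.CutsOff J l c) (h : S.IsSimple) (hx : x ∈ S.polyhedron) :
    LinearIndepOn ℝ (S.cut l c).normal ((S.cut l c).tight x) := by
  have hsome : LinearIndepOn ℝ (S.cut l c).normal (some '' S.tight x) :=
    LinearIndepOn.image_of_comp some (S.cut l c).normal (h.indep x hx)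
  by_cases hlx : l x = c
  · rw [tight_cut_of_eq hlx]
    refine hsome.insert ?_
    rw [Set.image_image]
    exact hc.notMem_span h hx hlx
  · rwa [tight_cut_of_ne hlx]

theorem isSimple_cut (hc : S.CutsOff J l c) (h : S.IsSimple) : (S.cut l c).IsSimple := by
  have hface : (S.face ∅).Nonempty := hc.nonempty.mono (face_anti (Set.empty_subset J))
  obtain ⟨v, hv, -, hvc⟩ := hc.exists_extremePoint_notMem_face h hface
    fun hs => hc.nontrivial.nonempty.ne_empty (Set.subset_empty_iff.1 hs)
  have hmem : ∀ {x}, x ∈ (S.cut l c).polyhedron ↔ x ∈ S.polyhedron ∧ l x ≤ c :=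
    Set.ext_iff.1 (S.polyhedron_cut l c) _
  refine ⟨h.isBounded.subset fun x hx => (hmem.1 hx).1, ⟨v, hmem.2 ⟨hv.1, hvc.le⟩⟩,
    fun x hx => hc.linearIndepOn_normal_cut h (hmem.1 hx).1, Option.forall.2 ⟨?_, fun i => ?_⟩⟩
  · obtain ⟨x, hx⟩ := hc.nonempty
    obtain ⟨z, hz, hlz⟩ := exists_mem_openSegment_apply_eq hvc (hc.lt_of_mem_face h hx)
    exact ⟨z, hmem.2 ⟨S.convex_polyhedron.openSegment_subset hv.1 hx.1 hz, hlz.le⟩, hlz⟩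
  · obtain ⟨u, hu, hui, huc⟩ := hc.exists_extremePoint_notMem_face h (h.face_singleton_nonempty i)
      hc.nontrivial.not_subset_singleton
    exact ⟨u, hmem.2 ⟨hu.1, huc.le⟩, hui.2 rfl⟩

theorem mem_extremePoints_cut_and_ne_iff (hc : S.CutsOff J l c) (h : S.IsSimple) :
    v ∈ (S.cut l c).polyhedron.extremePoints ℝ ∧ l v ≠ c ↔
      v ∈ S.polyhedron.extremePoints ℝ ∧ v ∉ S.face J := by
  rw [(hc.isSimple_cut h).mem_extremePoints_iff_ncard_tight,
    h.mem_extremePoints_iff_ncard_tight, polyhedron_cut]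
  constructor
  · rintro ⟨⟨hv, hn⟩, hne⟩
    rw [ncard_tight_cut_of_ne hne] at hn
    exact ⟨⟨hv.1, hn⟩, fun hvJ => (hc.lt_of_mem_face h hvJ).not_ge hv.2⟩
  · rintro ⟨hv, hvJ⟩
    have hlt := hc.neg_of_notMem v (h.mem_extremePoints_iff_ncard_tight.2 hv) hvJ
    rw [ncard_tight_cut_of_ne hlt.ne]
    exact ⟨⟨⟨hv.1, hlt.le⟩, hv.2⟩, hlt.ne⟩

theorem mem_extremePoints_cut_iff (hc : S.CutsOff J l c) (h : S.IsSimple) (hlw : l w = c) :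
    w ∈ (S.cut l c).polyhedron.extremePoints ℝ ↔
      w ∈ S.polyhedron ∧ (S.tight w).ncard + 1 = Module.finrank ℝ E := by
  rw [(hc.isSimple_cut h).mem_extremePoints_iff_ncard_tight, ncard_tight_cut_of_eq hlw,
    polyhedron_cut]
  exact and_congr_left fun _ => and_iff_left hlw.le

theorem exists_tight_eq_diff (hc : S.CutsOff J l c) (h : S.IsSimple)
    (hv : v ∈ S.polyhedron.extremePoints ℝ) (hvJ : v ∈ S.face J)
    (hw : w ∈ (S.cut l c).polyhedron.extremePoints ℝ) (hlw : l w = c)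
    (hwv : S.tight w ⊆ S.tight v) : ∃ j ∈ J, S.tight w = S.tight v \ {j} := by
  obtain ⟨hwS, hwn⟩ := (hc.mem_extremePoints_cut_iff h hlw).1 hw
  have hvn := (h.mem_extremePoints_iff_ncard_tight.1 hv).2
  have hdiff : (S.tight v \ S.tight w).ncard = 1 := by
    rw [Set.ncard_sdiff hwv (Set.toFinite _)]
    omega
  obtain ⟨j, hj⟩ := Set.ncard_eq_one.1 hdiff
  have hwj : S.tight w = S.tight v \ {j} := by
    rw [← hj, Set.sdiff_sdiff_right_self, Set.inter_eq_right.2 hwv]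
  refine ⟨j, not_imp_comm.1 (fun hjJ => ?_) (fun hwJ => (hc.lt_of_mem_face h hwJ).ne' hlw), hwj⟩
  exact ⟨hwS, hwj ▸ Set.subset_sdiff_singleton hvJ.2 hjJ⟩

theorem exists_extremePoint_over (hc : S.CutsOff J l c) (h : S.IsSimple)
    (hv : v ∈ S.polyhedron.extremePoints ℝ) (hvJ : v ∈ S.face J) {j : ι} (hj : j ∈ J) :
    ∃ w ∈ (S.cut l c).polyhedron.extremePoints ℝ, l w = c ∧ S.tight w = S.tight v \ {j} := by
  -- `w` is the point at height `c` on the edge of the polyhedron from `v` leaving the facet `j`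
  obtain ⟨u, hu, huK, huc⟩ := hc.exists_extremePoint_notMem_face h (K := S.tight v \ {j})
    ⟨v, hv.1, Set.sdiff_subset⟩ fun hs => (hs hj).2 rfl
  obtain ⟨w, hw, hlw⟩ := exists_mem_openSegment_apply_eq huc (hc.pos_of_mem v hv hvJ)
  have hwS := S.convex_polyhedron.openSegment_subset hu.1 hv.1 hw
  have hsub : S.tight v \ {j} ⊆ S.tight w :=
    tight_of_mem_openSegment hu.1 hv.1 hw ▸ Set.subset_inter huK.2 Set.sdiff_subset
  have hvn : (S.tight v \ {j}).ncard + 1 = Module.finrank ℝ E := by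
    rw [Set.ncard_sdiff_singleton_add_one (hvJ.2 hj) (Set.toFinite _),
      (h.mem_extremePoints_iff_ncard_tight.1 hv).2]
  have hwn : (S.tight w).ncard + 1 ≤ Module.finrank ℝ E := by
    rw [← ncard_tight_cut_of_eq hlw]
    exact (hc.isSimple_cut h).ncard_tight_le (S.polyhedron_cut l c ▸ ⟨hwS, hlw.le⟩)
  have hwv : S.tight w = S.tight v \ {j} :=
    (Set.eq_of_subset_of_ncard_le hsub (by omega) (Set.toFinite _)).symm
  exact ⟨w, (hc.mem_extremePoints_cut_iff h hlw).2 ⟨hwS, hwv ▸ hvn⟩, hlw, hwv⟩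

theorem ncard_extremePoints_over (hc : S.CutsOff J l c) (h : S.IsSimple)
    (hv : v ∈ S.polyhedron.extremePoints ℝ) (hvJ : v ∈ S.face J) :
    {w | w ∈ (S.cut l c).polyhedron.extremePoints ℝ ∧ l w = c ∧ S.tight w ⊆ S.tight v}.ncard =
      J.ncard := by
  choose f hf hlf hft using fun j : J => hc.exists_extremePoint_over h hv hvJ j.2
  symm
  refine Set.ncard_congr (fun j hj => f ⟨j, hj⟩)
    (fun j hj => ⟨hf _, hlf _, (hft ⟨j, hj⟩).le.trans Set.sdiff_subset⟩) ?_ ?_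
  · intro i j hi hj hij
    by_contra hne
    have hit : i ∈ S.tight (f ⟨j, hj⟩) := (hft ⟨j, hj⟩).ge ⟨hvJ.2 hi, hne⟩
    rw [← hij, hft] at hit
    exact hit.2 rfl
  · rintro w ⟨hw, hlw, hwv⟩
    obtain ⟨j, hj, hwj⟩ := hc.exists_tight_eq_diff h hv hvJ hw hlw hwv
    refine ⟨j, hj, eq_of_tight_subset hw ?_⟩
    rw [tight_cut_of_eq hlw, tight_cut_of_eq (hlf _), hft, hwj]

theorem existsUnique_extremePoint_under (hc : S.CutsOff J l c) (h : S.IsSimple)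
    (hw : w ∈ (S.cut l c).polyhedron.extremePoints ℝ) (hlw : l w = c) :
    ∃! v, (v ∈ S.polyhedron.extremePoints ℝ ∧ v ∈ S.face J) ∧ S.tight w ⊆ S.tight v := by
  have hwS : w ∈ S.polyhedron := ((hc.mem_extremePoints_cut_iff h hlw).1 hw).1
  obtain ⟨v, hv, hvw, hmax⟩ := exists_extremePoint_isMaxOn_face h.isBounded ⟨w, hwS, subset_rfl⟩ l
  have hlv : c ≤ l v := hlw ▸ hmax ⟨hwS, subset_rfl⟩
  refine ⟨v, ⟨⟨hv, hc.mem_face_of_le hv hlv⟩, hvw.2⟩, ?_⟩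
  rintro u ⟨⟨hu, huJ⟩, hwu⟩
  -- `u - w` is a multiple of `v - w`, and `l u ≤ l v`, so that `u` lies on the segment `[w, v]`
  refine (eq_of_tight_subset hu fun i hi => ?_).symm
  have hprop := congrArg (S.normal i)
    (smul_sub_eq_smul_sub_of_mem_extremePoints_cut hw hlw hwu hvw.2)
  have hlu := hc.pos_of_mem u hu huJ
  have hle : l u ≤ l v := hmax ⟨hu.1, hwu⟩
  have hiv := hv.1 i
  have hiw := hwS i
  simp only [map_sub, map_smul, smul_eq_mul] at hprop
  rw [mem_tight] at hi ⊢
  nlinarith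

end CutsOff

end FiniteDimensional

end Cut

end LinearSystem

/-! ### Blowups -/

namespace RCharPair

variable {n : ℕ}

section OfSystem

variable {ι : Type*} [Finite ι] {S : LinearSystem ι (Fin n → ℝ)} (h : S.IsSimple)
  (μ : ι → Fin n → ℤ) (hprim : ∀ i, IsPrimitiveVec (μ i))
  (hind : ∀ x ∈ S.polyhedron, LinearIndepOn ℤ μ (S.tight x))

/-- The pair consisting of a simple polytope and a characteristic function which are both given in
terms of the inequalities of a system. -/
def ofSystem : RCharPair n where
  poly := S.polyhedron
  isSimple := h.isSimplePolytope
  lam F := μ (h.isIrredundant.facetEquiv.symm F)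
  primitive F := hprim _
  indep T hT := by
    let e := h.isIrredundant.facetEquiv
    rcases T.eq_empty_or_nonempty with rfl | ⟨F₀, hF₀⟩
    · exact linearIndependent_empty_type
    obtain ⟨x, hx⟩ := hT
    have hmem : ∀ F ∈ T, x ∈ S.face {e.symm F} := fun F hF => by
      rw [← h.isIrredundant.coe_facetEquiv, Equiv.apply_symm_apply]
      exact Set.mem_iInter₂.1 hx F hF
    exact (hind x (hmem F₀ hF₀).1).linearIndependent.comp
      (fun F : T => ⟨e.symm F.1, (hmem F.1 F.2).2 rfl⟩) fun F G hFG =>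
        Subtype.ext (e.symm.injective (congrArg Subtype.val hFG))

theorem lam_ofSystem (i : ι) :
    (ofSystem h μ hprim hind).lam (h.isIrredundant.facetEquiv i) = μ i :=
  congrArg μ (Equiv.symm_apply_apply _ i)

theorem singOrder_ofSystem {x : Fin n → ℝ} (hx : x ∈ S.polyhedron) :
    (ofSystem h μ hprim hind).singOrder {x} = saturationIndex (μ '' S.tight x) := by
  have htight : h.isIrredundant.facetEquiv.symm '' {G | {x} ⊆ (G : Set (Fin n → ℝ))} =
      S.tight x := by
    rw [Equiv.image_symm_eq_preimage]
    ext i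
    rw [Set.mem_preimage, Set.mem_ofPred_eq, Set.singleton_subset_iff,
      LinearSystem.IsIrredundant.coe_facetEquiv, LinearSystem.mem_face_singleton, and_iff_right hx]
  have hvecs : (ofSystem h μ hprim hind).vecs {x} = μ '' S.tight x :=
    (Set.image_comp μ h.isIrredundant.facetEquiv.symm _).trans (congrArg _ htight)
  exact congrArg saturationIndex hvecs

end OfSystem

variable (A : RCharPair n)

instance : Finite A.Facet := A.isSimple.exists_system.1

instance : Fintype A.Facet := Fintype.ofFinite _

/-- A choice of inequalities for the polytope, exactly one for every facet. -/
def system : LinearSystem A.Facet (Fin n → ℝ) := A.isSimple.exists_system.2.choose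

theorem isSimple_system : A.system.IsSimple := A.isSimple.exists_system.2.choose_spec.1

theorem polyhedron_system : A.system.polyhedron = A.poly :=
  A.isSimple.exists_system.2.choose_spec.2.1

theorem face_system (G : A.Facet) : A.system.face {G} = G.1 :=
  A.isSimple.exists_system.2.choose_spec.2.2 G

theorem vertices_poly : vertices A.poly = A.system.polyhedron.extremePoints ℝ := by
  rw [← A.polyhedron_system, LinearSystem.vertices_polyhedron]

variable {A} {F : Set (Fin n → ℝ)} {G : A.Facet} {K : Set A.Facet} {x : Fin n → ℝ}

theorem mem_facet_iff : x ∈ G.1 ↔ x ∈ A.poly ∧ G ∈ A.system.tight x := by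
  rw [← A.face_system G, LinearSystem.mem_face_singleton, polyhedron_system]

theorem linearIndepOn_lam (hx : x ∈ A.poly) : LinearIndepOn ℤ A.lam (A.system.tight x) :=
  A.indep _ ⟨x, Set.mem_iInter₂.2 fun _ hG => mem_facet_iff.2 ⟨hx, hG⟩⟩

theorem setOf_face_subset (hK : (A.system.face K).Nonempty) :
    {G : A.Facet | A.system.face K ⊆ G.1} = K := by
  ext G
  rw [Set.mem_ofPred_eq, ← A.face_system G, A.isSimple_system.face_subset_face_iff hK,
    Set.singleton_subset_iff]

theorem face_setOf_subset (hF : IsFace A.poly F) : A.system.face {G | F ⊆ G.1} = F := by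
  have hFK := LinearSystem.eq_face_of_isExposed (A.polyhedron_system ▸ hF.1) hF.2
  have hK := setOf_face_subset (hFK ▸ hF.2)
  rw [← hFK] at hK
  rw [hK, ← hFK]

theorem singOrder_face (hK : (A.system.face K).Nonempty) :
    A.singOrder (A.system.face K) = saturationIndex (A.lam '' K) :=
  congrArg (fun T => saturationIndex (A.lam '' T)) (setOf_face_subset hK)

theorem singOrder_singleton (hx : x ∈ A.poly) :
    A.singOrder {x} = saturationIndex (A.lam '' A.system.tight x) := by
  refine congrArg (fun T => saturationIndex (A.lam '' T)) (Set.ext fun G => ?_)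
  rw [Set.mem_ofPred_eq, Set.singleton_subset_iff, mem_facet_iff, and_iff_right hx]

end RCharPair

theorem LinearSystem.exists_separating {ι E : Type*} [Finite ι] [NormedAddCommGroup E]
    [NormedSpace ℝ E] {S : LinearSystem ι E} {F : Set E} (hF : IsExposed ℝ S.polyhedron F)
    (hne : F.Nonempty) :
    ∃ (l : E →L[ℝ] ℝ) (c : ℝ), (∀ v ∈ S.polyhedron.extremePoints ℝ, v ∈ F → c < l v) ∧
      ∀ v ∈ S.polyhedron.extremePoints ℝ, v ∉ F → l v < c := by
  obtain ⟨l, rfl⟩ := hF hne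
  obtain ⟨x, hx, hmax⟩ := hne
  have hlt : ∀ v ∈ S.polyhedron.extremePoints ℝ,
      v ∉ {x ∈ S.polyhedron | ∀ y ∈ S.polyhedron, l y ≤ l x} → l v < l x := fun v hv hvF =>
    (hmax v hv.1).lt_of_ne fun he => hvF ⟨hv.1, fun y hy => he ▸ hmax y hy⟩
  have hev : ∀ᶠ c in 𝓝[<] (l x), ∀ v ∈ S.polyhedron.extremePoints ℝ,
      v ∉ {x ∈ S.polyhedron | ∀ y ∈ S.polyhedron, l y ≤ l x} → l v < c :=
    (eventually_all_finite S.finite_extremePoints).2 fun v hv => eventually_imp_distrib_left.2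
      fun hvF => nhdsWithin_le_nhds (lt_mem_nhds (hlt v hv hvF))
  obtain ⟨c, hc, hcx⟩ := (hev.and self_mem_nhdsWithin).exists
  exact ⟨l, c, fun v _ hv => lt_of_lt_of_le hcx (hv.2 x hx), hc⟩

section Exchange

variable {n : ℕ} {κ : Type*} {u : κ → Fin n → ℤ} {w : Fin n → ℤ} {T : Set κ} {r : κ → ℚ}
  {j : κ}

theorem linearIndepOn_insert_none_and_saturationIndex [Fintype κ] (hT : T.ncard = n)
    (hu : LinearIndepOn ℤ u T) (hr : ∀ i ∉ T, r i = 0)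
    (hw : ∀ a, (w a : ℚ) = ∑ i, r i * u i a) (hjT : j ∈ T) (hj : r j ≠ 0) :
    LinearIndepOn ℤ (fun o : Option κ => o.elim w u) (insert none (some '' (T \ {j}))) ∧
      (saturationIndex ((fun o : Option κ => o.elim w u) '' insert none (some '' (T \ {j}))) : ℚ) =
        |r j| * saturationIndex (u '' T) := by
  classical
  have := Fintype.ofFinite T
  let f : T → Option κ := Function.update (some ∘ Subtype.val) ⟨j, hjT⟩ none
  have hf : Function.Injective f := by
    intro a b hab
    simp only [f, Function.update_apply, Function.comp_apply] at hab
    grind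
  have hrange : Set.range f = insert none (some '' (T \ {j})) := by
    ext (_ | i)
    · simpa using ⟨j, hjT, Function.update_self ..⟩
    · simp [f, Function.update_apply]
      grind
  have hcomp : (fun o : Option κ => o.elim w u) ∘ f =
      Function.update (fun i : T => u i) ⟨j, hjT⟩ w :=
    Function.comp_update _ _ _ _
  have hwT (a : Fin n) : (w a : ℚ) = ∑ i : T, r i * u i a :=
    (hw a).trans (Fintype.sum_of_injective Subtype.val Subtype.val_injective _ _
      (fun i hi => by rw [hr i (by simpa using hi), zero_mul]) fun _ => rfl).symm
  have hcard : Fintype.card T = n := by rw [← Nat.card_eq_fintype_card, Nat.card_coe_set_eq, hT]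
  rw [← hrange, linearIndepOn_range_iff hf, ← Set.range_comp, hcomp, Set.image_eq_range]
  exact linearIndependent_update_and_saturationIndex (r := fun i : T => r i) hcard hu hwT hj

theorem saturationIndex_image_pos [Finite κ] (hT : T.ncard = n) (hu : LinearIndepOn ℤ u T) :
    0 < saturationIndex (u '' T) := by
  have := Fintype.ofFinite T
  rw [Set.image_eq_range]
  exact saturationIndex_pos (by rw [← Nat.card_eq_fintype_card, Nat.card_coe_set_eq, hT]) hu

end Exchange

namespace RCharPair

variable {n : ℕ} {A : RCharPair n} {J : Set A.Facet} {l : (Fin n → ℝ) →L[ℝ] ℝ} {c : ℝ}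
  {v w x : Fin n → ℝ}

/-- A characteristic vector for the new facet of a blowup along the face `A.system.face J`: a
primitive vector which is a combination of those of the facets in `J` with coefficients strictly
between `0` and `1`. -/
structure BlowupVector (A : RCharPair n) (J : Set A.Facet) where
  /-- the vector -/
  vec : Fin n → ℤ
  /-- the coefficients, extended by zero to the facets not in `J` -/
  coeff : A.Facet → ℚ
  primitive : IsPrimitiveVec vec
  coeff_pos : ∀ G ∈ J, 0 < coeff G
  coeff_lt_one : ∀ G ∈ J, coeff G < 1
  coeff_eq_zero : ∀ G ∉ J, coeff G = 0
  vec_eq_sum : ∀ a, (vec a : ℚ) = ∑ G, coeff G * A.lam G a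

theorem IsMaximalSingular.saturationIndex_eq_one {F : Set (Fin n → ℝ)}
    (hF : A.IsMaximalSingular F) {K : Set A.Facet} (hK : K ⊂ {G | F ⊆ G.1}) :
    saturationIndex (A.lam '' K) = 1 := by
  have hsub : F ⊆ A.system.face K :=
    (face_setOf_subset hF.1.1).ge.trans (LinearSystem.face_anti hK.subset)
  have hne : (A.system.face K).Nonempty := hF.1.1.2.mono hsub
  by_contra hsing
  have hle : A.system.face K ⊆ F :=
    hF.2 ⟨A.polyhedron_system ▸ A.system.isFace_face hne, (singOrder_face hne).trans_ne hsing⟩ hsub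
  refine hK.not_subset ?_
  rw [← A.isSimple_system.face_subset_face_iff hne, face_setOf_subset hF.1.1]
  exact hle

theorem IsMaximalSingular.nonempty_blowupVector {F : Set (Fin n → ℝ)}
    (hF : A.IsMaximalSingular F) : Nonempty (A.BlowupVector {G | F ⊆ G.1}) := by
  set J : Set A.Facet := {G | F ⊆ G.1}
  have := Fintype.ofFinite J
  obtain ⟨x, hx⟩ : (A.system.face J).Nonempty := face_setOf_subset hF.1.1 ▸ hF.1.1.2
  have hmin (K : Set J) (hK : K ≠ Set.univ) :
      saturationIndex ((fun j : J => A.lam j) '' K) = 1 := by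
    rw [← Set.image_image A.lam]
    refine hF.saturationIndex_eq_one ((Subtype.coe_image_subset J K).ssubset_of_ne fun h => hK ?_)
    exact Subtype.val_injective.image_injective (h.trans (Subtype.coe_image_univ J).symm)
  have hrange : A.lam '' J = Set.range fun j : J => A.lam j := Set.image_eq_range _ _
  obtain ⟨q, w, hq, hw, hwq⟩ := exists_isPrimitiveVec_of_minimal (u := fun j : J => A.lam j)
    ((linearIndepOn_lam (A.polyhedron_system ▸ hx.1)).mono hx.2) (hrange ▸ hF.1.2) hmin
  have hext (j : J) : Function.extend Subtype.val q 0 (j : A.Facet) = q j :=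
    Subtype.val_injective.extend_apply q 0 j
  have hzero : ∀ G ∉ J, Function.extend Subtype.val q 0 G = 0 := fun G hG =>
    Function.extend_apply' _ _ _ fun ⟨j, hj⟩ => hG (hj ▸ j.2)
  refine ⟨⟨w, Function.extend Subtype.val q 0, hw, fun G hG => (hext ⟨G, hG⟩).symm ▸ (hq _).1,
    fun G hG => (hext ⟨G, hG⟩).symm ▸ (hq _).2, hzero, fun a => (hwq a).trans ?_⟩⟩
  refine Fintype.sum_of_injective Subtype.val Subtype.val_injective _ _ (fun G hG => ?_)
    fun j => by rw [hext]
  rw [hzero G (by simpa using hG), zero_mul]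

namespace BlowupVector

theorem nontrivial (V : A.BlowupVector J) : J.Nontrivial := by
  -- otherwise `V.vec` is zero or a proper fraction of a primitive vector
  by_contra hJ
  rcases (Set.not_nontrivial_iff.1 hJ).eq_empty_or_singleton with rfl | ⟨G, rfl⟩
  · refine not_isUnit_zero (V.primitive 0 fun a => zero_dvd_iff.2 ?_)
    have hsum := V.vec_eq_sum a
    simp only [V.coeff_eq_zero _ (Set.notMem_empty _), zero_mul, Finset.sum_const_zero] at hsum
    exact_mod_cast hsum
  · have hden := (A.primitive G).den_eq_one (v := V.vec) (q := V.coeff G) fun a => by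
      rw [V.vec_eq_sum a]
      exact Fintype.sum_eq_single G fun G' hG' => by rw [V.coeff_eq_zero G' hG', zero_mul]
    have hint : ((V.coeff G).num : ℚ) = V.coeff G := Rat.den_eq_one_iff _ |>.1 hden
    have hpos := V.coeff_pos G rfl
    have hlt := V.coeff_lt_one G rfl
    rw [← hint] at hpos hlt
    norm_cast at hpos hlt
    omega

variable (V : A.BlowupVector J) (hc : A.system.CutsOff J l c)

/-- The characteristic vectors of the facets of the blowup, indexed by the inequalities. -/
def vecs : Option A.Facet → Fin n → ℤ := fun o => o.elim V.vec A.lam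

theorem isPrimitiveVec_vecs : ∀ o, IsPrimitiveVec (V.vecs o)
  | none => V.primitive
  | some G => A.primitive G

variable {V}
include hc

theorem linearIndepOn_vecs_and_saturationIndex_lt (hv : v ∈ A.system.polyhedron.extremePoints ℝ)
    (hvJ : v ∈ A.system.face J) (hw : w ∈ (A.system.cut l c).polyhedron.extremePoints ℝ)
    (hlw : l w = c) (hwv : A.system.tight w ⊆ A.system.tight v) :
    LinearIndepOn ℤ V.vecs ((A.system.cut l c).tight w) ∧
      saturationIndex (V.vecs '' (A.system.cut l c).tight w) <
        saturationIndex (A.lam '' A.system.tight v) := by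
  obtain ⟨j, hj, hwj⟩ := hc.exists_tight_eq_diff A.isSimple_system hv hvJ hw hlw hwv
  have hcard : (A.system.tight v).ncard = n :=
    (A.isSimple_system.mem_extremePoints_iff_ncard_tight.1 hv).2.trans (by simp)
  have hu := linearIndepOn_lam (A.polyhedron_system ▸ hv.1)
  obtain ⟨hind, hindex⟩ := linearIndepOn_insert_none_and_saturationIndex hcard hu
    (fun G hG => V.coeff_eq_zero G fun hGJ => hG (hvJ.2 hGJ)) V.vec_eq_sum (hvJ.2 hj)
    (V.coeff_pos j hj).ne'
  rw [LinearSystem.tight_cut_of_eq hlw, hwj]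
  refine ⟨hind, ?_⟩
  rw [abs_of_pos (V.coeff_pos j hj)] at hindex
  have hlt := mul_lt_of_lt_one_left (Nat.cast_pos.2 (saturationIndex_image_pos hcard hu))
    (V.coeff_lt_one j hj)
  rw [← hindex] at hlt
  exact Nat.cast_lt.1 hlt

theorem linearIndepOn_vecs (hx : x ∈ (A.system.cut l c).polyhedron) :
    LinearIndepOn ℤ V.vecs ((A.system.cut l c).tight x) := by
  obtain ⟨v, hv, hvx, -⟩ := LinearSystem.exists_extremePoint_isMaxOn_face
    (hc.isSimple_cut A.isSimple_system).isBounded ⟨x, hx, subset_rfl⟩ 0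
  refine LinearIndepOn.mono ?_ hvx.2
  by_cases hlv : l v = c
  · obtain ⟨u, ⟨⟨hu, huJ⟩, huv⟩, -⟩ := hc.existsUnique_extremePoint_under A.isSimple_system hv hlv
    exact (linearIndepOn_vecs_and_saturationIndex_lt hc hu huJ hv hlv huv).1
  · have hvA : v ∈ A.poly := A.polyhedron_system ▸ (A.system.polyhedron_cut l c ▸ hv.1).1
    rw [LinearSystem.tight_cut_of_ne hlv]
    exact LinearIndepOn.image_of_comp some V.vecs (linearIndepOn_lam hvA)

end BlowupVector

section Blowup

variable (V : A.BlowupVector J) (hc : A.system.CutsOff J l c)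

/-- The blowup of `A` along the face `A.system.face J`, which the hyperplane `l = c` cuts off, with
the vector `V.vec` on the new facet. -/
def blowup : RCharPair n :=
  ofSystem (hc.isSimple_cut A.isSimple_system) V.vecs V.isPrimitiveVec_vecs fun _ =>
    BlowupVector.linearIndepOn_vecs hc

/-- The facet of the blowup which lies in the cutting hyperplane. -/
def newFacet : (A.blowup V hc).Facet :=
  (hc.isSimple_cut A.isSimple_system).isIrredundant.facetEquiv none

theorem poly_blowup : (A.blowup V hc).poly = A.poly ∩ {x | l x ≤ c} := by
  rw [← A.polyhedron_system]
  exact A.system.polyhedron_cut l c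

theorem vertices_blowup :
    vertices (A.blowup V hc).poly = (A.system.cut l c).polyhedron.extremePoints ℝ :=
  LinearSystem.vertices_polyhedron _

theorem coe_newFacet : (newFacet V hc : Set (Fin n → ℝ)) = A.poly ∩ {x | l x = c} := by
  rw [← A.polyhedron_system]
  exact A.system.face_cut_none l c

theorem lam_newFacet : (A.blowup V hc).lam (newFacet V hc) = V.vec :=
  lam_ofSystem _ _ _ _ none

theorem singOrder_blowup (hx : x ∈ (A.system.cut l c).polyhedron) :
    (A.blowup V hc).singOrder {x} = saturationIndex (V.vecs '' (A.system.cut l c).tight x) :=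
  singOrder_ofSystem _ _ _ _ hx

theorem isBlowup_blowup : IsBlowup A (A.blowup V hc) (A.system.face J) l c where
  isFace := A.polyhedron_system ▸ A.system.isFace_face hc.nonempty
  ne_zero := by
    rintro rfl
    obtain ⟨x, hx⟩ := (hc.isSimple_cut A.isSimple_system).nonempty
    obtain ⟨y, hy⟩ := hc.nonempty
    rw [LinearSystem.polyhedron_cut] at hx
    exact (hc.lt_of_mem_face A.isSimple_system hy).not_ge hx.2
  pos_of_mem := A.vertices_poly ▸ hc.pos_of_mem
  neg_of_notMem := A.vertices_poly ▸ hc.neg_of_notMem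
  poly_eq := poly_blowup V hc
  lam_eq G G' hG := by
    have hG' : G' = (hc.isSimple_cut A.isSimple_system).isIrredundant.facetEquiv (some G) := by
      refine Subtype.ext (hG.trans ?_)
      rw [← A.face_system G]
      exact (A.system.face_cut_some l c G).symm
    rw [hG']
    exact lam_ofSystem _ _ _ _ (some G)

theorem vertices_blowup_sdiff_newFacet :
    vertices (A.blowup V hc).poly \ newFacet V hc = vertices A.poly \ A.system.face J := by
  ext v
  rw [Set.mem_sdiff, Set.mem_sdiff, A.vertices_poly, vertices_blowup,
    ← hc.mem_extremePoints_cut_and_ne_iff A.isSimple_system, coe_newFacet]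
  refine and_congr_right fun hv => not_congr (and_iff_right ?_)
  exact A.polyhedron_system ▸ (A.system.polyhedron_cut l c ▸ hv.1).1

theorem singOrder_blowup_of_notMem (hv : v ∈ vertices A.poly) (hvJ : v ∉ A.system.face J) :
    (A.blowup V hc).singOrder {v} = A.singOrder {v} := by
  rw [vertices_poly] at hv
  have hlt := hc.neg_of_notMem v hv hvJ
  rw [singOrder_blowup V hc (A.system.polyhedron_cut l c ▸ ⟨hv.1, hlt.le⟩),
    singOrder_singleton (A.polyhedron_system ▸ hv.1), LinearSystem.tight_cut_of_ne hlt.ne,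
    Set.image_image]
  rfl

theorem mem_verticesOver_newFacet_iff (hv : v ∈ vertices A.poly) :
    w ∈ verticesOver A (A.blowup V hc) (newFacet V hc) v ↔
      w ∈ (A.system.cut l c).polyhedron.extremePoints ℝ ∧ l w = c ∧
        A.system.tight w ⊆ A.system.tight v := by
  rw [verticesOver, Set.mem_ofPred_eq, vertices_blowup, coe_newFacet]
  refine and_congr_right fun hw => ?_
  have hwA : w ∈ A.poly := A.polyhedron_system ▸ (A.system.polyhedron_cut l c ▸ hw.1).1
  have hvA : v ∈ A.poly := hv.1.subset rfl
  refine and_congr (and_iff_right hwA) (forall_congr' fun G => ?_)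
  rw [mem_facet_iff, mem_facet_iff, and_iff_right hwA, and_iff_right hvA]

theorem existsUnique_mem_verticesOver (hw : w ∈ vertices (A.blowup V hc).poly)
    (hwE : w ∈ (newFacet V hc).1) :
    ∃! v, v ∈ vertices A.poly ∩ A.system.face J ∧
      w ∈ verticesOver A (A.blowup V hc) (newFacet V hc) v := by
  have hlw : l w = c := (coe_newFacet V hc ▸ hwE).2
  have hw' := vertices_blowup V hc ▸ hw
  refine (existsUnique_congr fun v => ?_).1
    (hc.existsUnique_extremePoint_under A.isSimple_system hw' hlw)
  rw [Set.mem_inter_iff, ← vertices_poly]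
  refine and_congr_right fun hv => ?_
  rw [mem_verticesOver_newFacet_iff V hc hv.1, and_iff_right hw', and_iff_right hlw]

theorem ncard_verticesOver_newFacet (hv : v ∈ vertices A.poly) (hvJ : v ∈ A.system.face J) :
    (verticesOver A (A.blowup V hc) (newFacet V hc) v).ncard = J.ncard := by
  rw [← hc.ncard_extremePoints_over A.isSimple_system (A.vertices_poly ▸ hv) hvJ]
  exact congrArg Set.ncard (Set.ext fun w => mem_verticesOver_newFacet_iff V hc hv)

theorem singOrder_blowup_lt (hv : v ∈ vertices A.poly) (hvJ : v ∈ A.system.face J)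
    (hw : w ∈ verticesOver A (A.blowup V hc) (newFacet V hc) v) :
    (A.blowup V hc).singOrder {w} < A.singOrder {v} := by
  obtain ⟨hw, hlw, hwv⟩ := (mem_verticesOver_newFacet_iff V hc hv).1 hw
  rw [singOrder_blowup V hc hw.1, singOrder_singleton (hv.1.subset rfl)]
  exact (BlowupVector.linearIndepOn_vecs_and_saturationIndex_lt hc (A.vertices_poly ▸ hv) hvJ hw hlw
    hwv).2

end Blowup

theorem IsMaximalSingular.exists_isResolutionStep {F : Set (Fin n → ℝ)}
    (hF : A.IsMaximalSingular F) : ∃ B, A.IsResolutionStep B := by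
  set J : Set A.Facet := {G | F ⊆ G.1}
  have hFJ : A.system.face J = F := face_setOf_subset hF.1.1
  obtain ⟨V⟩ : Nonempty (A.BlowupVector J) := hF.nonempty_blowupVector
  have hV : V.vec ≠ 0 := fun h0 => not_isUnit_zero (V.primitive 0 fun a => by simp [h0])
  obtain ⟨l, c, hpos, hneg⟩ := LinearSystem.exists_separating (S := A.system)
    (A.polyhedron_system.symm ▸ hF.1.1.1) hF.1.1.2
  rw [← hFJ] at hpos hneg hF
  have hc : A.system.CutsOff J l c := ⟨hF.1.1.2, V.nontrivial, hpos, hneg⟩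
  have e : Fin J.ncard ≃ J := (Finite.equivFinOfCardEq (Nat.card_coe_set_eq J)).symm
  have hJ (j : Fin J.ncard) : (e j : A.Facet) ∈ J := (e j).2
  refine ⟨A.blowup V hc, _, l, c, hF, isBlowup_blowup V hc, newFacet V hc, coe_newFacet V hc,
    J.ncard, fun j => e j, Subtype.val_injective.comp e.injective, ?_,
    ⟨fun j => V.coeff (e j), V.vec, 1, fun j => ?_, hV, fun a => ?_, one_pos,
      (one_smul ..).symm.trans (congrArg _ (lam_newFacet V hc).symm)⟩,
    vertices_blowup_sdiff_newFacet V hc,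
    fun v hv => singOrder_blowup_of_notMem V hc hv.1 hv.2,
    fun w hw => existsUnique_mem_verticesOver V hc hw.1 hw.2,
    fun v hv => ⟨ncard_verticesOver_newFacet V hc hv.1 hv.2, fun w =>
      singOrder_blowup_lt V hc hv.1 hv.2⟩⟩
  · rw [hFJ]
    exact (e.surjective.range_comp _).trans Subtype.range_coe
  · rw [abs_of_pos (V.coeff_pos _ (hJ j))]
    exact ⟨V.coeff_pos _ (hJ j), V.coeff_lt_one _ (hJ j)⟩
  · rw [V.vec_eq_sum]
    refine (Fintype.sum_of_injective _ (Subtype.val_injective.comp e.injective) _ _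
      (fun G hG => ?_) fun _ => rfl).symm
    rw [V.coeff_eq_zero G fun hGJ => hG ⟨e.symm ⟨G, hGJ⟩, by simp⟩, zero_mul]

end RCharPair

/-! ### Descent -/

theorem finsum_mem_lt_finsum_mem_of_nonempty {α : Type*} {s : Set α} {f g : α → ℕ} (hs : s.Finite)
    (hne : s.Nonempty) (h : ∀ x ∈ s, f x < g x) : ∑ᶠ x ∈ s, f x < ∑ᶠ x ∈ s, g x := by
  rw [finsum_mem_eq_finite_toFinset_sum _ hs, finsum_mem_eq_finite_toFinset_sum _ hs]
  exact Finset.sum_lt_sum_of_nonempty (hs.toFinset_nonempty.2 hne) (by simpa using h)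

theorem finsum_mem_pow_lt_pow {α : Type*} {s : Set α} {f : α → ℕ} {N m : ℕ} (hs : s.Finite)
    (hcard : s.ncard < N) (h : ∀ x ∈ s, f x < m) : ∑ᶠ x ∈ s, N ^ f x < N ^ m := by
  have hN : 0 < N := Nat.zero_lt_of_lt hcard
  obtain rfl | hne := s.eq_empty_or_nonempty
  · simpa using pow_pos hN m
  obtain ⟨x, hx⟩ := hne
  calc
    ∑ᶠ x ∈ s, N ^ f x ≤ s.ncard * N ^ (m - 1) := by
      rw [finsum_mem_eq_finite_toFinset_sum _ hs, Set.ncard_eq_toFinset_card s hs]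
      exact Finset.sum_le_card_nsmul _ _ _ fun y hy =>
        Nat.pow_le_pow_right hN (Nat.le_sub_one_of_lt (h y (hs.mem_toFinset.1 hy)))
    _ < N * N ^ (m - 1) := Nat.mul_lt_mul_of_pos_right hcard (pow_pos hN _)
    _ = N ^ m := by rw [← pow_succ', Nat.sub_add_cancel (Nat.one_le_of_lt (h x hx))]

namespace RCharPair

variable {n : ℕ} {A B : RCharPair n} {F : Set (Fin n → ℝ)}

theorem finite_vertices (A : RCharPair n) : (vertices A.poly).Finite :=
  A.vertices_poly ▸ A.system.finite_extremePoints

theorem exists_mem_vertices_mem (hF : IsFace A.poly F) : (vertices A.poly ∩ F).Nonempty := by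
  obtain ⟨v, hv, hvF, -⟩ := LinearSystem.exists_extremePoint_isMaxOn_face (S := A.system)
    A.isSimple_system.isBounded ((face_setOf_subset hF).symm ▸ hF.2) 0
  exact ⟨v, A.vertices_poly ▸ hv, face_setOf_subset hF ▸ hvF⟩

theorem ncard_setOf_face_subset_le (hF : IsFace A.poly F) : {G : A.Facet | F ⊆ G.1}.ncard ≤ n := by
  obtain ⟨x, hx⟩ := hF.2
  have hxA : x ∈ A.system.polyhedron := A.polyhedron_system ▸ hF.1.subset hx
  refine (Set.ncard_le_ncard fun G hG => ?_).trans
    ((A.isSimple_system.ncard_tight_le hxA).trans_eq (Module.finrank_fin_fun ℝ))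
  exact (mem_facet_iff.1 (hG hx)).2

/-- The sum of `(n + 1) ^ |G_v|` over the vertices `v`. It decreases in a resolution step, in which
every vertex of the face is replaced by at most `n` vertices of smaller order. -/
def complexity (A : RCharPair n) : ℕ := ∑ᶠ v ∈ vertices A.poly, (n + 1) ^ A.singOrder {v}

theorem IsResolutionStep.complexity_lt (h : A.IsResolutionStep B) :
    B.complexity < A.complexity := by
  obtain ⟨F, l, c, hmax, -, E, -, k, i, hi, hrange, -, hdiff, hord, huniq, hover⟩ := h
  have hfin (v) : (verticesOver A B E v).Finite := B.finite_vertices.subset fun w hw => hw.1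
  have hFfin : (vertices A.poly ∩ F).Finite := A.finite_vertices.inter_of_left F
  have hk : k ≤ n := by
    rw [← Nat.card_fin k, ← Set.ncard_range_of_injective hi, hrange]
    exact ncard_setOf_face_subset_le hmax.1.1
  have hE : vertices B.poly ∩ E.1 = ⋃ v ∈ vertices A.poly ∩ F, verticesOver A B E v := by
    refine Set.Subset.antisymm (fun w hw => ?_) (Set.iUnion₂_subset fun v _ w hw => ⟨hw.1, hw.2.1⟩)
    obtain ⟨v, ⟨hv, hwv⟩, -⟩ := huniq w hw
    exact Set.mem_biUnion hv hwv
  have hdisj : (vertices A.poly ∩ F).PairwiseDisjoint (verticesOver A B E) :=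
    fun u hu v hv huv => Set.disjoint_left.2 fun w hwu hwv =>
      huv ((huniq w ⟨hwu.1, hwu.2.1⟩).unique ⟨hu, hwu⟩ ⟨hv, hwv⟩)
  have hlt (v) (hv : v ∈ vertices A.poly ∩ F) :
      ∑ᶠ w ∈ verticesOver A B E v, (n + 1) ^ B.singOrder {w} < (n + 1) ^ A.singOrder {v} :=
    finsum_mem_pow_lt_pow (hfin v) ((hover v hv).1.trans_lt (Nat.lt_succ_of_le hk)) (hover v hv).2
  rw [complexity, complexity, ← finsum_mem_inter_add_sdiff E.1 B.finite_vertices,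
    ← finsum_mem_inter_add_sdiff F A.finite_vertices, hdiff, hE,
    finsum_mem_biUnion hdisj hFfin fun v _ => hfin v,
    finsum_mem_congr rfl fun v hv => congrArg ((n + 1) ^ ·) (hord v hv)]
  exact Nat.add_lt_add_right
    (finsum_mem_lt_finsum_mem_of_nonempty hFfin (exists_mem_vertices_mem hmax.1.1) hlt) _

theorem exists_isMaximalSingular (hF : IsFace A.poly F) (hsing : A.singOrder F ≠ 1) :
    ∃ G, A.IsMaximalSingular G := by
  have hfaces : {G | IsFace A.poly G ∧ A.singOrder G ≠ 1}.Finite :=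
    (Set.finite_range A.system.face).subset fun G hG => ⟨_, face_setOf_subset hG.1⟩
  exact hfaces.exists_maximal ⟨F, hF, hsing⟩

end RCharPair

/-! ### Tori -/

theorem prod_zpow_eq_zpow_sum {ι G : Type*} [CommGroup G] (s : Finset ι) (f : ι → ℤ) (g : G) :
    ∏ i ∈ s, g ^ f i = g ^ ∑ i ∈ s, f i :=
  (map_sum (zmultiplesHom (Additive G) (Additive.ofMul g)) f s).symm

section TorusHom

variable {l m n G : Type*} [Fintype n] [CommGroup G]

/-- The homomorphism of tori given by an integer matrix, which maps `t` to the point with the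
coordinates `∏ j, t j ^ M i j`. The group `G` in place of the circle is arbitrary. -/
def torusHom (M : Matrix m n ℤ) : (n → G) →* (m → G) where
  toFun t i := ∏ j, t j ^ M i j
  map_one' := by
    ext
    simp
  map_mul' s t := by
    ext
    simp [mul_zpow, Finset.prod_mul_distrib]

theorem torusHom_apply (M : Matrix m n ℤ) (t : n → G) (i : m) :
    torusHom M t i = ∏ j, t j ^ M i j :=
  rfl

theorem torusHom_mul [Fintype m] (M : Matrix l m ℤ) (N : Matrix m n ℤ) (t : n → G) :
    torusHom (M * N) t = torusHom M (torusHom N t) := by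
  ext i
  simp only [torusHom_apply, Matrix.mul_apply, ← Finset.prod_zpow, ← zpow_mul]
  rw [Finset.prod_comm]
  refine Finset.prod_congr rfl fun k _ => ?_
  rw [prod_zpow_eq_zpow_sum]
  simp only [mul_comm]

theorem torusHom_one [DecidableEq n] (t : n → G) : torusHom 1 t = t := by
  ext i
  rw [torusHom_apply, Finset.prod_eq_single i (fun j _ hj => by
    rw [Matrix.one_apply_ne hj.symm, zpow_zero]) (by simp), Matrix.one_apply_eq, zpow_one]

theorem torusHom_zpow (M : Matrix m n ℤ) (v : n → ℤ) (z : G) :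
    torusHom M (fun i => z ^ v i) = fun i => z ^ M.mulVec v i := by
  ext i
  simp only [torusHom_apply, ← zpow_mul, prod_zpow_eq_zpow_sum, Matrix.mulVec, dotProduct,
    mul_comm]

variable [TopologicalSpace G] [IsTopologicalGroup G]

theorem continuous_torusHom (M : Matrix m n ℤ) : Continuous (torusHom (G := G) M) :=
  continuous_pi fun _ => continuous_finsetProd _ fun j _ => (continuous_apply j).zpow _

/-- The automorphism of a torus given by a pair of mutually inverse integer matrices. -/
def torusEquiv [DecidableEq n] (M N : Matrix n n ℤ) (hMN : M * N = 1) (hNM : N * M = 1) :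
    (n → G) ≃ₜ* (n → G) where
  toFun := torusHom M
  invFun := torusHom N
  left_inv t := by rw [← torusHom_mul, hNM, torusHom_one]
  right_inv t := by rw [← torusHom_mul, hMN, torusHom_one]
  map_mul' := map_mul _
  continuous_toFun := continuous_torusHom M
  continuous_invFun := continuous_torusHom N

end TorusHom

/-- The phase of a complex number, with the value `1` at `0`. -/
def phase (z : ℂ) : Circle := Circle.exp z.arg

theorem norm_mul_phase (z : ℂ) : (‖z‖ : ℂ) * phase z = z := by
  rw [phase, Circle.coe_exp, Complex.norm_mul_exp_arg_mul_I]

theorem coe_phase {z : ℂ} (hz : z ≠ 0) : (phase z : ℂ) = z / ‖z‖ := by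
  rw [eq_div_iff (Complex.ofReal_ne_zero.2 (norm_ne_zero_iff.2 hz)), mul_comm, norm_mul_phase]

/-! ### Corners -/

namespace RCharPair

variable {n : ℕ}

/-- A vertex of the polytope at which the vectors of the facets form a basis of `ℤⁿ`, with a
numbering of the facets through it. -/
structure Corner (A : RCharPair n) where
  /-- the vertex -/
  pt : Fin n → ℝ
  mem_vertices : pt ∈ vertices A.poly
  /-- the numbering of the facets through the vertex -/
  facet : Fin n ≃ A.system.tight pt
  /-- the directions of the edges at the vertex, dual to the inner normals of the facets -/
  dir : Fin n → Fin n → ℝ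
  normal_dir : ∀ i j, A.system.normal (facet i) (dir j) = if i = j then -1 else 0
  /-- the inverse of the matrix whose columns are the vectors of the facets -/
  mat : Matrix (Fin n) (Fin n) ℤ
  mat_mul : mat * Matrix.of (fun i j => A.lam (facet j) i) = 1

variable {A : RCharPair n}

theorem nonempty_equiv_tight {v : Fin n → ℝ} (hv : v ∈ vertices A.poly) :
    Nonempty (Fin n ≃ A.system.tight v) := by
  have := Fintype.ofFinite (A.system.tight v)
  rw [vertices_poly, A.isSimple_system.mem_extremePoints_iff_ncard_tight,
    Module.finrank_fin_fun] at hv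
  rw [← Fintype.card_eq, Fintype.card_fin, ← Nat.card_eq_fintype_card, Nat.card_coe_set_eq, hv.2]

theorem exists_corner {v : Fin n → ℝ} (hv : v ∈ vertices A.poly) (hs : A.singOrder {v} = 1) :
    ∃ C : Corner A, C.pt = v := by
  have hvA : v ∈ A.poly := hv.1.subset rfl
  obtain ⟨σ⟩ := nonempty_equiv_tight hv
  have hu : LinearIndependent ℤ fun j => A.lam (σ j) :=
    (linearIndepOn_lam hvA).linearIndependent.comp σ σ.injective
  have hrange : Set.range (fun j => A.lam (σ j)) = A.lam '' A.system.tight v := by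
    rw [Set.image_eq_range]
    exact σ.surjective.range_comp fun G : A.system.tight v => A.lam G
  have hdet : IsUnit (Matrix.of fun i j => A.lam (σ j) i).det := by
    rw [← Matrix.det_transpose, Int.isUnit_iff_natAbs_eq, ← hs, singOrder_singleton hvA, ← hrange]
    exact (saturationIndex_range hu).symm
  choose d hd using fun j => exists_forall_mem_apply_eq
    (A.isSimple_system.indep v (A.polyhedron_system ▸ hvA))
    fun G => if G = (σ j : A.Facet) then -1 else 0
  exact ⟨{
    pt := v
    mem_vertices := hv
    facet := σ
    dir := d
    normal_dir := fun i j => by simp [hd j _ (σ i).2, ← Subtype.ext_iff]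
    mat := (Matrix.of fun i j => A.lam (σ j) i)⁻¹
    mat_mul := Matrix.nonsing_inv_mul _ hdet }, rfl⟩

namespace Corner

variable (C : Corner A) {x : Fin n → ℝ}

theorem pt_mem : C.pt ∈ A.poly := C.mem_vertices.1.subset rfl

/-- The matrix whose columns are the vectors of the facets through the corner. -/
def colMat : Matrix (Fin n) (Fin n) ℤ := Matrix.of fun i j => A.lam (C.facet j) i

theorem mat_mul_colMat : C.mat * C.colMat = 1 := C.mat_mul

theorem colMat_mul_mat : C.colMat * C.mat = 1 := mul_eq_one_comm.1 C.mat_mul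

theorem mat_mulVec_lam (j : Fin n) : C.mat.mulVec (A.lam (C.facet j)) = Pi.single j 1 := by
  ext i
  rw [Pi.single_apply, ← Matrix.one_apply, ← C.mat_mul, Matrix.mul_apply]
  rfl

/-- The affine coordinates at the corner: the slacks of the inequalities which are active there. -/
def coord (x : Fin n → ℝ) (j : Fin n) : ℝ :=
  A.system.bound (C.facet j) - A.system.normal (C.facet j) x

/-- The inverse of `coord`. -/
def point (y : Fin n → ℝ) : Fin n → ℝ := C.pt + ∑ j, y j • C.dir j

theorem coord_point (y : Fin n → ℝ) : C.coord (C.point y) = y := by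
  ext j
  simp [coord, point, LinearSystem.mem_tight.1 (C.facet j).2, C.normal_dir]

theorem coord_eq_zero_iff {j : Fin n} :
    C.coord x j = 0 ↔ (C.facet j : A.Facet) ∈ A.system.tight x := by
  rw [coord, sub_eq_zero, LinearSystem.mem_tight, eq_comm]

theorem point_coord (x : Fin n → ℝ) : C.point (C.coord x) = x := by
  have hpt := LinearSystem.mem_extremePoints_iff.1 (A.vertices_poly ▸ C.mem_vertices)
  refine sub_eq_zero.1 (hpt.2 _ fun G hG => ?_)
  obtain ⟨j, hj⟩ := C.facet.surjective ⟨G, hG⟩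
  obtain rfl : (C.facet j : A.Facet) = G := congrArg Subtype.val hj
  have h := congrFun (C.coord_point (C.coord x)) j
  rw [map_sub, sub_eq_zero]
  exact sub_right_injective h

theorem coord_nonneg (hx : x ∈ A.poly) (j : Fin n) : 0 ≤ C.coord x j :=
  sub_nonneg.2 ((A.polyhedron_system ▸ hx : x ∈ A.system.polyhedron) _)

theorem continuous_coord : Continuous C.coord :=
  continuous_pi fun _ => continuous_const.sub (ContinuousLinearMap.continuous _)

theorem continuous_point : Continuous C.point := by
  unfold point
  fun_prop

/-- The points which lie only on facets through the corner. -/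
def nbhd : Set (Fin n → ℝ) :=
  {x | ∀ G ∉ A.system.tight C.pt, A.system.normal G x < A.system.bound G}

theorem isOpen_nbhd : IsOpen C.nbhd := by
  have hnbhd : C.nbhd =
      ⋂ G ∈ (A.system.tight C.pt)ᶜ, {x | A.system.normal G x < A.system.bound G} := by
    ext x
    simp [nbhd]
  rw [hnbhd]
  exact (Set.toFinite _).isOpen_biInter fun G _ =>
    isOpen_lt (A.system.normal G).continuous continuous_const

theorem mem_nbhd_iff (hx : x ∈ A.poly) :
    x ∈ C.nbhd ↔ A.system.tight x ⊆ A.system.tight C.pt :=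
  ⟨fun hxn G hG => by_contra fun hGC => (hxn G hGC).ne hG, fun hs _ hG =>
    LinearSystem.lt_of_notMem_tight (A.polyhedron_system.symm ▸ hx) fun hGx => hG (hs hGx)⟩

theorem point_mem {y : Fin n → ℝ} (hy : ∀ j, 0 ≤ y j) (hn : C.point y ∈ C.nbhd) :
    C.point y ∈ A.poly := by
  rw [← A.polyhedron_system]
  intro G
  by_cases hG : G ∈ A.system.tight C.pt
  · obtain ⟨j, hj⟩ := C.facet.surjective ⟨G, hG⟩
    obtain rfl : (C.facet j : A.Facet) = G := congrArg Subtype.val hj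
    exact sub_nonneg.1 ((hy j).trans_eq (congrFun (C.coord_point y) j).symm)
  · exact (hn G hG).le

theorem torusHom_mat_zpow_lam (j : Fin n) (z : Circle) :
    torusHom C.mat (fun i => z ^ A.lam (C.facet j) i) = Pi.mulSingle j z := by
  ext i
  rw [torusHom_zpow, C.mat_mulVec_lam]
  obtain rfl | h := eq_or_ne i j
  · simp
  · simp [h]

theorem mem_iSup_circleSubgroup {K : Set (Fin n)} {t : Fin n → Circle} :
    t ∈ ⨆ j : K, circleSubgroup (A.lam (C.facet j)) ↔ ∀ j ∉ K, torusHom C.mat t j = 1 := by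
  constructor
  · suffices h : ⨆ j : K, circleSubgroup (A.lam (C.facet j)) ≤
        (Subgroup.pi Kᶜ fun _ => ⊥).comap (torusHom C.mat) from fun ht j hj => h ht j hj
    refine iSup_le fun ⟨k, hk⟩ => ?_
    rintro _ ⟨z, rfl⟩ j hj
    have hjk : j ≠ k := fun h => hj (h ▸ hk)
    exact (congrFun (C.torusHom_mat_zpow_lam k z) j).trans (Pi.mulSingle_eq_of_ne hjk _)
  · intro ht
    have hprod : t = ∏ j, fun i => torusHom C.mat t j ^ A.lam (C.facet j) i := by
      conv_lhs => rw [← torusHom_one t, ← C.colMat_mul_mat, torusHom_mul]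
      ext i
      rw [torusHom_apply, Finset.prod_apply]
      rfl
    rw [hprod]
    refine Subgroup.prod_mem _ fun j _ => ?_
    by_cases hj : j ∈ K
    · exact Subgroup.mem_iSup_of_mem (S := fun j : K => circleSubgroup (A.lam (C.facet j)))
        ⟨j, hj⟩ ⟨_, rfl⟩
    · simp only [ht j hj, one_zpow]
      exact one_mem _

theorem faceTorus_singleton (hx : x ∈ A.poly) (hxn : x ∈ C.nbhd) :
    A.faceTorus {x} = ⨆ j : {j | C.coord x j = 0}, circleSubgroup (A.lam (C.facet j)) := by
  rw [C.mem_nbhd_iff hx] at hxn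
  refine le_antisymm (iSup_le fun ⟨G, hG⟩ => ?_) (iSup_le fun ⟨j, hj⟩ => ?_)
  · have hGx := (mem_facet_iff.1 (hG rfl)).2
    obtain ⟨j, hj⟩ := C.facet.surjective ⟨G, hxn hGx⟩
    obtain rfl : (C.facet j : A.Facet) = G := congrArg Subtype.val hj
    exact le_iSup_of_le ⟨j, C.coord_eq_zero_iff.2 hGx⟩ le_rfl
  · have hG := mem_facet_iff.2 ⟨hx, C.coord_eq_zero_iff.1 hj⟩
    exact le_iSup_of_le ⟨_, Set.singleton_subset_iff.2 hG⟩ le_rfl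

theorem mem_faceTorus_iff (hx : x ∈ A.poly) (hxn : x ∈ C.nbhd) {t : Fin n → Circle} :
    t ∈ A.faceTorus {x} ↔ ∀ j, C.coord x j ≠ 0 → torusHom C.mat t j = 1 := by
  rw [C.faceTorus_singleton hx hxn, C.mem_iSup_circleSubgroup]
  rfl

end Corner

end RCharPair

/-! ### The space of a pair and its charts at the corners -/

namespace RCharPair

variable {n : ℕ} {A : RCharPair n}

/-- The projection `Tⁿ × P → M(P, λ)`. -/
def proj (A : RCharPair n) (p : (Fin n → Circle) × A.poly) : A.Space := Quotient.mk A.toricSetoid p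

theorem proj_surjective (A : RCharPair n) : Function.Surjective A.proj := Quotient.mk_surjective

theorem isQuotientMap_proj (A : RCharPair n) : IsQuotientMap A.proj := isQuotientMap_quotient_mk'

theorem proj_eq_iff {p q : (Fin n → Circle) × A.poly} :
    A.proj p = A.proj q ↔ p.2 = q.2 ∧ p.1⁻¹ * q.1 ∈ A.faceTorus {p.2.1} := Quotient.eq

theorem smul_proj (t : Fin n → Circle) (p : (Fin n → Circle) × A.poly) :
    t • A.proj p = A.proj (t * p.1, p.2) := rfl

theorem orbitMap_smul (t : Fin n → Circle) (m : A.Space) :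
    A.orbitMap (t • m) = A.orbitMap m := by
  obtain ⟨p, rfl⟩ := A.proj_surjective m
  rfl

theorem continuous_orbitMap (A : RCharPair n) : Continuous A.orbitMap :=
  A.isQuotientMap_proj.continuous_iff.2 continuous_snd

theorem orbitMap_surjective (A : RCharPair n) : Function.Surjective A.orbitMap :=
  fun x => ⟨A.proj (1, x), rfl⟩

theorem orbitMap_eq_orbitMap_iff (m m' : A.Space) :
    A.orbitMap m = A.orbitMap m' ↔ ∃ t : Fin n → Circle, t • m = m' := by
  constructor
  · obtain ⟨⟨s, x⟩, rfl⟩ := A.proj_surjective m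
    obtain ⟨⟨s', x'⟩, rfl⟩ := A.proj_surjective m'
    rintro (rfl : x = x')
    exact ⟨s' * s⁻¹, by rw [smul_proj, inv_mul_cancel_right]⟩
  · rintro ⟨t, rfl⟩
    exact (orbitMap_smul t m).symm

instance compactSpace_poly (A : RCharPair n) : CompactSpace A.poly :=
  isCompact_iff_compactSpace.1 <| A.polyhedron_system ▸
    LinearSystem.isCompact_polyhedron A.isSimple_system.isBounded

instance compactSpace_space (A : RCharPair n) : CompactSpace A.Space :=
  A.proj_surjective.compactSpace A.isQuotientMap_proj.continuous

/-- The moment map of `ℂⁿ`. -/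
def sqNorm (z : Fin n → ℂ) (j : Fin n) : ℝ := ‖z j‖ ^ 2

theorem contDiff_sqNorm : ContDiff ℝ ∞ (sqNorm (n := n)) :=
  contDiff_pi.2 fun j => (contDiff_apply ℝ ℂ j).norm_sq ℝ

namespace Corner

variable (C D : Corner A)

/-- The chart at a corner, in polar coordinates on `Tⁿ × P`. -/
def preChart (p : (Fin n → Circle) × A.poly) (j : Fin n) : ℂ :=
  (√(C.coord p.2 j) : ℝ) * torusHom C.mat p.1 j

theorem continuous_preChart : Continuous C.preChart := by
  have := C.continuous_coord
  have := continuous_torusHom (G := Circle) C.mat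
  unfold preChart
  fun_prop

theorem sqNorm_preChart (p : (Fin n → Circle) × A.poly) : sqNorm (C.preChart p) = C.coord p.2 := by
  ext j
  simp [sqNorm, preChart, Circle.norm_coe, Real.sq_sqrt (C.coord_nonneg p.2.2 j)]

theorem point_sqNorm_preChart (p : (Fin n → Circle) × A.poly) :
    C.point (sqNorm (C.preChart p)) = p.2 := by
  rw [C.sqNorm_preChart, C.point_coord]

theorem preChart_eq_iff {p q : (Fin n → Circle) × A.poly} (hp : p.2.1 ∈ C.nbhd) :
    C.preChart p = C.preChart q ↔ A.proj p = A.proj q := by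
  rw [proj_eq_iff, C.mem_faceTorus_iff p.2.2 hp]
  have key (hpq : p.2 = q.2) (j : Fin n) : C.preChart p j = C.preChart q j ↔
      (C.coord p.2 j ≠ 0 → torusHom C.mat (p.1⁻¹ * q.1) j = 1) := by
    simp only [preChart, ← hpq, mul_eq_mul_left_iff, Complex.ofReal_eq_zero,
      Real.sqrt_eq_zero (C.coord_nonneg p.2.2 j), Circle.coe_inj, map_mul, map_inv, Pi.mul_apply,
      Pi.inv_apply, inv_mul_eq_one]
    tauto
  constructor
  · intro h
    have hpq : p.2 = q.2 := Subtype.ext <| by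
      rw [← C.point_sqNorm_preChart p, ← C.point_sqNorm_preChart q, h]
    exact ⟨hpq, fun j => (key hpq j).1 (congrFun h j)⟩
  · exact fun ⟨hpq, h⟩ => funext fun j => (key hpq j).2 (h j)

/-- The domain of the chart. -/
def chartSource : Set A.Space := {m | (A.orbitMap m).1 ∈ C.nbhd}

/-- The image of the chart. -/
def chartTarget : Set (Fin n → ℂ) := {z | C.point (sqNorm z) ∈ C.nbhd}

/-- The map of the chart, obtained by descending `preChart`; it is meaningful on `chartSource`. -/
def chartFun (m : A.Space) : Fin n → ℂ := C.preChart (Function.surjInv A.proj_surjective m)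

theorem chartFun_proj {p : (Fin n → Circle) × A.poly} (hp : p.2.1 ∈ C.nbhd) :
    C.chartFun (A.proj p) = C.preChart p :=
  ((C.preChart_eq_iff hp).2 (Function.surjInv_eq A.proj_surjective _).symm).symm

open Classical in
/-- The inverse of the chart; it is meaningful on `chartTarget`. -/
def chartInv (z : Fin n → ℂ) : A.Space :=
  A.proj (torusHom C.colMat (phase ∘ z),
    if hz : C.point (sqNorm z) ∈ A.poly then ⟨_, hz⟩ else ⟨C.pt, C.pt_mem⟩)

variable {C} {z : Fin n → ℂ} {p : (Fin n → Circle) × A.poly} {m : A.Space}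

theorem point_sqNorm_mem (hz : z ∈ C.chartTarget) : C.point (sqNorm z) ∈ A.poly :=
  C.point_mem (fun _ => sq_nonneg _) hz

theorem chartInv_of_mem (hz : z ∈ C.chartTarget) :
    C.chartInv z = A.proj (torusHom C.colMat (phase ∘ z), ⟨_, point_sqNorm_mem hz⟩) := by
  rw [chartInv, dif_pos]

theorem preChart_colMat_phase (hz : C.point (sqNorm z) ∈ A.poly) :
    C.preChart (torusHom C.colMat (phase ∘ z), ⟨_, hz⟩) = z := by
  ext j
  rw [preChart, ← torusHom_mul, C.mat_mul_colMat, torusHom_one, C.coord_point, sqNorm,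
    Real.sqrt_sq (norm_nonneg _), Function.comp_apply, norm_mul_phase]

theorem preChart_mem_chartTarget_iff : C.preChart p ∈ C.chartTarget ↔ p.2.1 ∈ C.nbhd := by
  rw [chartTarget, Set.mem_ofPred_eq, C.point_sqNorm_preChart]

theorem chartInv_preChart (hp : p.2.1 ∈ C.nbhd) : C.chartInv (C.preChart p) = A.proj p := by
  rw [chartInv_of_mem (preChart_mem_chartTarget_iff.2 hp), eq_comm, ← C.preChart_eq_iff hp,
    preChart_colMat_phase]

theorem orbitMap_chartInv (hz : z ∈ C.chartTarget) :
    (A.orbitMap (C.chartInv z) : Fin n → ℝ) = C.point (sqNorm z) := by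
  rw [chartInv_of_mem hz]
  rfl

theorem chartFun_chartInv (hz : z ∈ C.chartTarget) (hzD : C.point (sqNorm z) ∈ D.nbhd) :
    D.chartFun (C.chartInv z) =
      D.preChart (torusHom C.colMat (phase ∘ z), ⟨_, point_sqNorm_mem hz⟩) := by
  rw [chartInv_of_mem hz]
  exact D.chartFun_proj (p := (_, ⟨_, point_sqNorm_mem hz⟩)) hzD

variable (C)

theorem isOpen_chartSource : IsOpen C.chartSource :=
  C.isOpen_nbhd.preimage (continuous_subtype_val.comp A.continuous_orbitMap)

theorem isOpen_chartTarget : IsOpen C.chartTarget :=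
  C.isOpen_nbhd.preimage (C.continuous_point.comp contDiff_sqNorm.continuous)

theorem continuousOn_chartFun : ContinuousOn C.chartFun C.chartSource := by
  rw [A.isQuotientMap_proj.continuousOn_isOpen_iff C.isOpen_chartSource]
  exact C.continuous_preChart.continuousOn.congr fun p hp => C.chartFun_proj hp

/-- As `phase` is not continuous at `0`, this cannot be read off the formula for `chartInv`;
instead, `preChart` is a closed map by compactness of `Tⁿ × P`. -/
theorem continuousOn_chartInv : ContinuousOn C.chartInv C.chartTarget := by
  refine continuousOn_iff_isClosed.2 fun t ht => ⟨C.preChart '' (A.proj ⁻¹' t),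
    C.continuous_preChart.isClosedMap _ (ht.preimage A.isQuotientMap_proj.continuous), ?_⟩
  ext z
  refine and_congr_left fun hz => ⟨fun hzt => ?_, ?_⟩
  · rw [Set.mem_preimage, chartInv_of_mem hz] at hzt
    exact ⟨_, hzt, preChart_colMat_phase (point_sqNorm_mem hz)⟩
  · rintro ⟨p, hp, rfl⟩
    rwa [Set.mem_preimage, chartInv_preChart (preChart_mem_chartTarget_iff.1 hz)]

/-- The chart at a corner. -/
def chart : OpenPartialHomeomorph A.Space (Fin n → ℂ) where
  toFun := C.chartFun
  invFun := C.chartInv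
  source := C.chartSource
  target := C.chartTarget
  map_source' m hm := by
    obtain ⟨p, rfl⟩ := A.proj_surjective m
    rw [C.chartFun_proj hm]
    exact preChart_mem_chartTarget_iff.2 hm
  map_target' z hz := by
    rw [chartSource, Set.mem_ofPred_eq, orbitMap_chartInv hz]
    exact hz
  left_inv' m hm := by
    obtain ⟨p, rfl⟩ := A.proj_surjective m
    rw [C.chartFun_proj hm, chartInv_preChart hm]
  right_inv' z hz := by rw [chartFun_chartInv C hz hz, preChart_colMat_phase]
  open_source := C.isOpen_chartSource
  open_target := C.isOpen_chartTarget
  continuousOn_toFun := C.continuousOn_chartFun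
  continuousOn_invFun := C.continuousOn_chartInv

theorem smul_mem_chartSource (hm : m ∈ C.chartSource) (t : Fin n → Circle) :
    t • m ∈ C.chartSource := by
  rwa [chartSource, Set.mem_ofPred_eq, orbitMap_smul]

theorem chartFun_smul (hm : m ∈ C.chartSource) (t : Fin n → Circle) :
    C.chartFun (t • m) = fun j => (torusHom (G := Circle) C.mat t j : ℂ) * C.chartFun m j := by
  obtain ⟨p, rfl⟩ := A.proj_surjective m
  rw [smul_proj, C.chartFun_proj (p := (t * p.1, p.2)) hm, C.chartFun_proj hm]
  ext j
  simp only [preChart, map_mul, Pi.mul_apply, Circle.coe_mul, mul_left_comm]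

end Corner

end RCharPair

/-! ### Smoothness of the coordinate changes -/

theorem contDiffOn_coe_phase : ContDiffOn ℝ ∞ (fun z => (phase z : ℂ)) {0}ᶜ := by
  have h : ContDiffOn ℝ ∞ (fun z : ℂ => ‖z‖⁻¹ • z) {0}ᶜ :=
    ((contDiffOn_id.norm ℝ fun _ hz => hz).inv fun z (hz : z ≠ 0) => norm_ne_zero_iff.2 hz).smul
      contDiffOn_id
  refine h.congr fun z hz => ?_
  rw [coe_phase hz, Complex.real_smul, Complex.ofReal_inv, div_eq_inv_mul]

theorem contDiffOn_coe_phase_zpow (k : ℤ) :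
    ContDiffOn ℝ ∞ (fun z => (phase z : ℂ) ^ k) {0}ᶜ := by
  cases k with
  | ofNat k => exact contDiffOn_coe_phase.pow k
  | negSucc k =>
    exact (contDiffOn_coe_phase.pow (k + 1)).inv fun z _ => pow_ne_zero _ (phase z).coe_ne_zero

namespace RCharPair

variable {n : ℕ} {A : RCharPair n}

namespace Corner

variable {C D : Corner A} {j k : Fin n}

theorem mat_mul_colMat_apply_self (h : (C.facet k : A.Facet) = D.facet j) :
    (D.mat * C.colMat) j k = 1 :=
  (congrFun (congrArg (D.mat.mulVec <| A.lam ·) h) j).trans <| by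
    rw [D.mat_mulVec_lam, Pi.single_eq_same]

theorem mat_mul_colMat_apply_of_ne (hk : (C.facet k : A.Facet) ∈ A.system.tight D.pt)
    (h : (C.facet k : A.Facet) ≠ D.facet j) : (D.mat * C.colMat) j k = 0 := by
  obtain ⟨i, hi⟩ := D.facet.surjective ⟨_, hk⟩
  have hik : (C.facet k : A.Facet) = D.facet i := congrArg Subtype.val hi.symm
  refine (congrFun (congrArg (D.mat.mulVec <| A.lam ·) hik) j).trans ?_
  rw [D.mat_mulVec_lam, Pi.single_eq_of_ne]
  rintro rfl
  exact h hik

variable (C D) in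
open Classical in
/-- The coordinates at `C` belonging to the facets which do not pass through `D`. They have no
zeros on the overlap of the two charts. -/
def awayFrom : Finset (Fin n) := {k | (C.facet k : A.Facet) ∉ A.system.tight D.pt}

theorem mem_awayFrom : k ∈ awayFrom C D ↔ (C.facet k : A.Facet) ∉ A.system.tight D.pt := by
  simp [awayFrom]

theorem torusHom_mat_mul_colMat_of_eq (h : (C.facet k : A.Facet) = D.facet j)
    (t : Fin n → Circle) : torusHom (D.mat * C.colMat) t j =
      t k * ∏ i ∈ awayFrom C D, t i ^ (D.mat * C.colMat) j i := by
  have hk : k ∉ awayFrom C D := fun hk => mem_awayFrom.1 hk (h ▸ (D.facet j).2)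
  rw [torusHom_apply, ← Finset.prod_subset (Finset.subset_univ (insert k (awayFrom C D))),
    Finset.prod_insert hk, mat_mul_colMat_apply_self h, zpow_one]
  intro i _ hi
  rw [Finset.mem_insert, not_or, mem_awayFrom, not_not] at hi
  have hij : (C.facet i : A.Facet) ≠ D.facet j := fun hij =>
    hi.1 (C.facet.injective (Subtype.ext (hij.trans h.symm)))
  rw [mat_mul_colMat_apply_of_ne hi.2 hij, zpow_zero]

theorem torusHom_mat_mul_colMat_of_notMem (h : (D.facet j : A.Facet) ∉ A.system.tight C.pt)
    (t : Fin n → Circle) : torusHom (D.mat * C.colMat) t j =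
      ∏ i ∈ awayFrom C D, t i ^ (D.mat * C.colMat) j i := by
  rw [torusHom_apply, ← Finset.prod_subset (Finset.subset_univ (awayFrom C D))]
  intro i _ hi
  rw [mem_awayFrom, not_not] at hi
  have hij : (C.facet i : A.Facet) ≠ D.facet j := fun hij => h (hij ▸ (C.facet i).2)
  rw [mat_mul_colMat_apply_of_ne hi hij, zpow_zero]

variable (C D) in
/-- The domain of the coordinate change from `C` to `D`. -/
def overlap : Set (Fin n → ℂ) := {z | C.point (sqNorm z) ∈ C.nbhd ∩ D.nbhd}

theorem ne_zero_of_mem_awayFrom (hk : k ∈ awayFrom C D) {z : Fin n → ℂ} (hz : z ∈ overlap C D) :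
    z k ≠ 0 := fun h => by
  have hcoord : C.coord (C.point (sqNorm z)) k = 0 := by rw [C.coord_point, sqNorm, h]; simp
  exact (hz.2 _ (mem_awayFrom.1 hk)).ne (C.coord_eq_zero_iff.1 hcoord)

variable (C D)

theorem contDiffOn_prod_awayFrom (m : Fin n → ℤ) :
    ContDiffOn ℝ ∞ (fun z => (↑(∏ k ∈ awayFrom C D, phase (z k) ^ m k) : ℂ)) (overlap C D) := by
  have h : ContDiffOn ℝ ∞ (fun z => ∏ k ∈ awayFrom C D, (phase (z k) : ℂ) ^ m k) (overlap C D) :=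
    contDiffOn_prod fun k hk => (contDiffOn_coe_phase_zpow (m k)).comp
      (contDiff_apply ℝ ℂ k).contDiffOn fun _ hz => ne_zero_of_mem_awayFrom hk hz
  refine h.congr fun z _ => (map_prod Circle.coeHom _ _).trans <| Finset.prod_congr rfl fun k _ =>
    Circle.coe_zpow _ _

theorem contDiff_coord_point_sqNorm (j : Fin n) :
    ContDiff ℝ ∞ fun z : Fin n → ℂ => D.coord (C.point (sqNorm z)) j := by
  have hcoord : ContDiff ℝ ∞ fun x => D.coord x j :=
    contDiff_const.sub (ContinuousLinearMap.contDiff _)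
  have hpoint : ContDiff ℝ ∞ C.point :=
    contDiff_const.add (ContDiff.sum fun i _ => (contDiff_apply ℝ ℝ i).smul contDiff_const)
  exact hcoord.comp (hpoint.comp contDiff_sqNorm)

/-- The coordinate change is `√(coord j) * ∏ k, phase (z k) ^ N j k` for an integer matrix `N`. If
the `j`-th facet at `D` is the `k`-th facet at `C`, then `√(coord j) = ‖z k‖` completes the factor
`phase (z k)` to `z k`; otherwise, the root is taken of a positive number. -/
theorem contDiffOn_chartFun_chartInv :
    ContDiffOn ℝ ∞ (fun z => D.chartFun (C.chartInv z)) (overlap C D) := by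
  refine contDiffOn_pi.2 fun j => ?_
  have hform (z : Fin n → ℂ) (hz : z ∈ overlap C D) : D.chartFun (C.chartInv z) j =
      (√(D.coord (C.point (sqNorm z)) j) : ℝ) *
        torusHom (D.mat * C.colMat) (phase ∘ z) j := by
    rw [chartFun_chartInv D hz.1 hz.2, preChart, ← torusHom_mul]
  have hprod := contDiffOn_prod_awayFrom C D fun k => (D.mat * C.colMat) j k
  by_cases hj : (D.facet j : A.Facet) ∈ A.system.tight C.pt
  · obtain ⟨k, hk⟩ := C.facet.surjective ⟨_, hj⟩
    have hkj : (C.facet k : A.Facet) = D.facet j := congrArg Subtype.val hk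
    refine ((contDiff_apply ℝ ℂ k).contDiffOn.mul hprod).congr fun z hz => ?_
    have hcoord : D.coord (C.point (sqNorm z)) j = ‖z k‖ ^ 2 := by
      have h := congrFun (C.coord_point (sqNorm z)) k
      rwa [coord, hkj] at h
    rw [hform z hz, torusHom_mat_mul_colMat_of_eq hkj, hcoord, Real.sqrt_sq (norm_nonneg _),
      Circle.coe_mul, ← mul_assoc, Function.comp_apply, norm_mul_phase]
    rfl
  · have hsqrt := (C.contDiff_coord_point_sqNorm D j).contDiffOn.sqrt
      fun z (hz : z ∈ overlap C D) => (sub_pos.2 (hz.1 _ hj)).ne'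
    refine ((Complex.ofRealCLM.contDiff.comp_contDiffOn hsqrt).mul hprod).congr fun z hz => ?_
    rw [hform z hz, torusHom_mat_mul_colMat_of_notMem hj]
    rfl

end Corner

end RCharPair

/-! ### Pairs without singular vertices -/

theorem t2Space_of_fiber_subset_source {X Y Z : Type*} [TopologicalSpace X] [TopologicalSpace Y]
    [TopologicalSpace Z] [T2Space Y] [T2Space Z] {f : X → Y} (hf : Continuous f)
    (h : ∀ x, ∃ e : OpenPartialHomeomorph X Z, f ⁻¹' {f x} ⊆ e.source) : T2Space X := by
  refine ⟨fun x x' hne => ?_⟩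
  by_cases hfx : f x' = f x
  · obtain ⟨e, he⟩ := h x
    have hx : x ∈ e.source := he rfl
    have hx' : x' ∈ e.source := he hfx
    obtain ⟨U, U', hU, hU', hxU, hxU', hd⟩ := t2_separation (e.injOn.ne hx hx' hne)
    exact ⟨_, _, e.isOpen_inter_preimage hU, e.isOpen_inter_preimage hU', ⟨hx, hxU⟩,
      ⟨hx', hxU'⟩, (hd.preimage e).mono Set.inter_subset_right Set.inter_subset_right⟩
  · exact separated_by_continuous hf (Ne.symm hfx)

namespace RCharPair

variable {n : ℕ} {A : RCharPair n}

theorem Corner.span_range_lam (C : Corner A) :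
    Submodule.span ℤ (Set.range fun G : A.system.tight C.pt => A.lam G) = ⊤ := by
  refine eq_top_iff.2 fun v _ => ?_
  have hv : v = ∑ j, C.mat.mulVec v j • A.lam (C.facet j) :=
    calc
      v = C.colMat.mulVec (C.mat.mulVec v) := by
        rw [Matrix.mulVec_mulVec, C.colMat_mul_mat, Matrix.one_mulVec]
      _ = ∑ j, C.mat.mulVec v j • A.lam (C.facet j) := by
        ext i
        simp [Matrix.mulVec, dotProduct, Corner.colMat, mul_comm]
  rw [hv]
  exact Submodule.sum_smul_mem _ _ fun j _ => Submodule.subset_span ⟨C.facet j, rfl⟩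

section Regular

variable (hreg : ∀ v ∈ vertices A.poly, A.singOrder {v} = 1)

include hreg

theorem exists_corner_mem_nbhd {x : Fin n → ℝ} (hx : x ∈ A.poly) : ∃ C : Corner A, x ∈ C.nbhd := by
  obtain ⟨v, hv, hvx, -⟩ := LinearSystem.exists_extremePoint_isMaxOn_face
    A.isSimple_system.isBounded ⟨x, A.polyhedron_system ▸ hx, subset_refl (A.system.tight x)⟩ 0
  rw [← A.vertices_poly] at hv
  obtain ⟨C, rfl⟩ := exists_corner hv (hreg v hv)
  exact ⟨C, (C.mem_nbhd_iff hx).2 hvx.2⟩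

theorem isCharacteristic_of_singOrder_eq_one : A.IsCharacteristic := by
  intro S hS
  obtain ⟨x, hx, hSx⟩ : ∃ x ∈ A.poly, S ⊆ A.system.tight x := by
    obtain rfl | ⟨G, hG⟩ := S.eq_empty_or_nonempty
    · obtain ⟨x, hx⟩ := A.isSimple_system.nonempty
      exact ⟨x, A.polyhedron_system ▸ hx, Set.empty_subset _⟩
    · obtain ⟨x, hx⟩ := hS
      rw [Set.mem_iInter₂] at hx
      exact ⟨x, (mem_facet_iff.1 (hx G hG)).1, fun K hK => (mem_facet_iff.1 (hx K hK)).2⟩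
  obtain ⟨C, hC⟩ := exists_corner_mem_nbhd hreg hx
  have hSC : S ⊆ A.system.tight C.pt := hSx.trans ((C.mem_nbhd_iff hx).1 hC)
  have himage : A.lam '' S =
      (fun G : A.system.tight C.pt => A.lam G) '' (Subtype.val ⁻¹' S) := by
    rw [← Set.image_image A.lam Subtype.val, Subtype.image_preimage_coe,
      Set.inter_eq_right.2 hSC]
  rw [himage]
  exact ⟨_, (linearIndepOn_lam C.pt_mem).linearIndependent.isCompl_span_image C.span_range_lam
    isCompl_compl⟩

theorem t2Space_space : T2Space A.Space :=
  t2Space_of_fiber_subset_source A.continuous_orbitMap fun m => by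
    obtain ⟨C, hC⟩ := exists_corner_mem_nbhd hreg (A.orbitMap m).2
    refine ⟨C.chart, fun m' hm' => ?_⟩
    change (A.orbitMap m').1 ∈ C.nbhd
    rwa [Set.mem_singleton_iff.1 hm']

/-- The atlas consisting of the charts at the corners. -/
abbrev chartedSpace : ChartedSpace (Fin n → ℂ) A.Space where
  atlas := Set.range Corner.chart
  chartAt m := (exists_corner_mem_nbhd hreg (A.orbitMap m).2).choose.chart
  mem_chart_source m := (exists_corner_mem_nbhd hreg (A.orbitMap m).2).choose_spec
  chart_mem_atlas _ := ⟨_, rfl⟩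

theorem isManifold_space :
    letI := chartedSpace hreg
    IsManifold 𝓘(ℝ, Fin n → ℂ) ∞ A.Space := by
  let _ := chartedSpace hreg
  refine isManifold_of_contDiffOn _ _ _ ?_
  rintro _ _ ⟨C, rfl⟩ ⟨D, rfl⟩
  refine (C.contDiffOn_chartFun_chartInv D).mono ?_
  rintro z ⟨⟨hz, hzD⟩, -⟩
  exact ⟨hz, Corner.orbitMap_chartInv hz ▸ hzD⟩

theorem isToricManifold_of_singOrder_eq_one : A.IsToricManifold where
  characteristic := isCharacteristic_of_singOrder_eq_one hreg
  compactSpace := A.compactSpace_space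
  t2Space := t2Space_space hreg
  secondCountable :=
    letI := chartedSpace hreg
    ChartedSpace.secondCountable_of_sigmaCompact (Fin n → ℂ) A.Space
  exists_smooth := by
    refine ⟨chartedSpace hreg, isManifold_space hreg, ?_⟩
    rintro _ ⟨C, rfl⟩
    exact ⟨fun t m hm => Corner.smul_mem_chartSource C hm t,
      torusEquiv C.mat C.colMat C.mat_mul_colMat C.colMat_mul_mat,
      fun t m hm => C.chartFun_smul hm t⟩
  isQuotientMap :=
    A.continuous_orbitMap.isClosedMap.isQuotientMap A.continuous_orbitMap A.orbitMap_surjective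
  orbitMap_eq_iff := orbitMap_eq_orbitMap_iff

end Regular

theorem isToricManifold_or_exists_isResolutionStep (A : RCharPair n) :
    A.IsToricManifold ∨ ∃ B, A.IsResolutionStep B := by
  by_cases hreg : ∀ v ∈ vertices A.poly, A.singOrder {v} = 1
  · exact .inl (isToricManifold_of_singOrder_eq_one hreg)
  · push Not at hreg
    obtain ⟨v, hv, hsing⟩ := hreg
    obtain ⟨F, hF⟩ := exists_isMaximalSingular hv hsing
    exact .inr hF.exists_isResolutionStep

end RCharPair

end ToricOrb

end

theorem theorem2p6 (n : ℕ) (hn : 1 ≤ n) (A : ToricOrb.RCharPair n) :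
    ∃ (d : ℕ) (X : ℕ → ToricOrb.RCharPair n), X 0 = A ∧
      (∀ i < d, (X i).IsResolutionStep (X (i + 1))) ∧
      (X d).IsToricManifold := by
  induction hN : A.complexity using Nat.strong_induction_on generalizing A with
  | _ N ih =>
    obtain hA | ⟨B, hB⟩ := A.isToricManifold_or_exists_isResolutionStep
    · exact ⟨0, fun _ => A, rfl, fun i hi => absurd hi i.not_lt_zero, hA⟩
    · obtain ⟨d, X, rfl, hX, hXd⟩ := ih _ (hN ▸ hB.complexity_lt) B rfl
      refine ⟨d + 1, fun i => Nat.casesOn i A X, rfl, ?_, hXd⟩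
      rintro (_ | i) hi
      · exact hB
      · exact hX i (Nat.lt_of_succ_lt_succ hi)
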